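/- **Setting.** For $n\ge 1$ let $\overline{M}_{n+1}(\mathbb R)$ be the real locus of the Deligne–Mumford space of stable genus $0$ curves with $n+1$ marked points ($\overline M_2(\mathbb R)$ is a point), i.e. the closure of $\{x\in\mathbb R^n : x_i\neq x_j\}/\mathrm{Aff}(\mathbb R)$ in $\prod_{S\subseteq\{1,\dots,n\},\,|S|\ge2}\mathbb P(\mathbb R^S/\mathbb R(1,\dots,1))$. The group $S_n$ acts by permuting the first $n$ marked points, and $\gamma:\overline M_{n+1}\times\overline M_{k_1+1}\times\cdots\times\overline M_{k_n+1}\to\overline M_{k_1+\cdots+k_n+1}$ (with $n,k_i\ge1$) glues the last marked point of the $i$-th attached curve to the $i$-th marked point of the first curve. Let $\overline M_{n+1}(\mathbb R)_+$ be the closure of the set of configurations with $x_1>\cdots>x_n$, and let $(12)3$ and $1(23)$ be the two points of $\overline M_4(\mathbb R)$ obtained by gluing $\overline M_3(\mathbb R)=\{pt\}$ to itself at the first, respectively the second, marked point. Let $\Xi$ be a set, regarded as a discrete space. A *$\Xi$-coloured operadic covering* $\mathcal X$ is a sequence of covering spaces $\mathcal X_{n+1}\to\overline M_{n+1}(\mathbb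 R)\times\Xi^{n}\times\Xi$, $n\ge1$ (possibly with empty fibres; write $\mathcal X(\lambda_1,\dots,\lambda_n)^\mu$ for the part over $(\lambda_1,\dots,\lambda_n,\mu)$), with continuous actions of $S_n$ on $\mathcal X_{n+1}$ lying over the actions on $\overline M_{n+1}(\mathbb R)$ and $\Xi^n$, and continuous maps $$\Gamma:\mathcal X(\mu_1,\dots,\mu_n)^\nu\times\mathcal X(\lambda^{(1)})^{\mu_1}\times\cdots\times\mathcal X(\lambda^{(n)})^{\mu_n}\to\mathcal X(\lambda^{(1)}\sqcup\cdots\sqcup\lambda^{(n)})^\nu$$ covering $\gamma$, such that (1) these data satisfy the unit, associativity and equivariance axioms of a coloured operad, where $\mathcal X(\lambda)^\mu$ is a point $1_\lambda$ if $\lambda=\mu$ and is empty otherwise; (2) for all $\lambda^{(1)},\dots,\lambda^{(n)},\nu$, the map $\Gamma$ is a bijection from the disjoint union of its sources over all $(\mu_1,\dots,\mu_n)\in\Xi^n$ to the restriction of $\mathcal X(\lambda^{(1)}\sqcup\cdots\sqcup\lambda^{(n)})^\nu$ to the image of $\gamma$. A $\Xi$-graded set is a family $(A_\lambda)_{\lambda\in\Xi}$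 of finite sets, only finitely many of them non-empty; a morphism $A\to B$ is a family of maps $A_\lambda\to B_\lambda$. A *coboundary category* is a category with a bifunctor $\otimes$, natural isomorphisms $\alpha_{A,B,C}:(A\otimes B)\otimes C\to A\otimes(B\otimes C)$ satisfying the pentagon axiom, and natural isomorphisms $\sigma_{A,B}:A\otimes B\to B\otimes A$ with $\sigma_{B,A}\circ\sigma_{A,B}=\mathrm{id}$ and $$(\sigma_{B,C}\otimes\mathrm{id})\circ\sigma_{A,B\otimes C}\circ\alpha_{A,B,C}=\alpha_{C,B,A}^{-1}\circ(\mathrm{id}\otimes\sigma_{A,B})\circ\sigma_{A\otimes B,C};$$ no unit object is required. **Theorem.** Let $\mathcal X$ be a $\Xi$-coloured operadic covering such that for all $\lambda_1,\lambda_2\in\Xi$ the set $\bigsqcup_{\mu}\mathcal X(\lambda_1,\lambda_2)^\mu$ is finite. Then $\overline M_4(\mathbb R)_+$ is contractible and contains $(12)3$ and $1(23)$, and there is exactly one coboundary category $\mathtt C(\mathcal X)$ whose underlying category is that of $\Xi$-graded sets and whose structure is as follows. * The tensor product is $$(A\otimes B)_\mu=\bigsqcup_{\lambda_1,\lambda_2\in\Xi}\mathcal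 X(\lambda_1,\lambda_2)^\mu\times A_{\lambda_1}\times B_{\lambda_2},$$ with the evident action on morphisms. * An element of $((A\otimes B)\otimes C)_\nu$ consists of $a\in A_{\lambda_1}$, $b\in B_{\lambda_2}$, $c\in C_{\lambda_3}$, $y\in\mathcal X(\lambda_1,\lambda_2)^\mu$ and $x\in\mathcal X(\mu,\lambda_3)^\nu$. The associator sends it to the element of $(A\otimes(B\otimes C))_\nu$ with the same $a,b,c$ and with the $y'\in\mathcal X(\lambda_2,\lambda_3)^{\mu'}$, $x'\in\mathcal X(\lambda_1,\mu')^\nu$ for which $\Gamma(x';1_{\lambda_1},y')$ is the image of $\Gamma(x;y,1_{\lambda_3})$ under the monodromy of $\mathcal X_4$ along any path from $(12)3$ to $1(23)$ that stays in $\overline M_4(\mathbb R)_+$. * The commutor sends $(x,a,b)$, with $x\in\mathcal X(\lambda_1,\lambda_2)^\mu$, to $(w_{12}\cdot x,b,a)$, where $w_{12}$ is the transposition in $S_2$. -/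

import Mathlib

open CategoryTheory Topology
open scoped CategoryTheory.Prod

universe u

namespace RealModuli

/-! ## The real moduli spaces of stable genus 0 curves

For a finite set `ι` of marked points (besides the point at infinity) the space `M ι` is the
real De Concini--Procesi model of the root system of type A: the closure of the space of
configurations of distinct real points, modulo real affine maps, inside the product of the
projective spaces `ℙ(𝔥 / V_S^⊥)`, where `𝔥 = ℝ^ι / ℝ(1, …, 1)` and `V_S^⊥` consists of the vectors
which are constant on `S`, for all `S ⊆ ι` with at least two elements. -/

section Moduli

variable {ι κ : Type}

/-- The vectors in `ℝ^ι` which are not constant on `S`. -/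
def NonconstOn (S : Set ι) (x : ι → ℝ) : Prop := ∃ i ∈ S, ∃ j ∈ S, x i ≠ x j

/-- Two vectors, not constant on `S`, are equivalent if their restrictions to `S` agree up to
a real affine map `t ↦ a * t + b`, `a ≠ 0`. -/
def lineSetoid (S : Set ι) : Setoid {x : ι → ℝ // NonconstOn S x} where
  r x y := ∃ a b : ℝ, a ≠ 0 ∧ ∀ i ∈ S, y.1 i = a * x.1 i + b
  iseqv :=
    { refl := fun _ => ⟨1, 0, one_ne_zero, fun _ _ => by ring⟩
      symm := by
        rintro x y ⟨a, b, ha, h⟩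
        refine ⟨a⁻¹, -(a⁻¹ * b), inv_ne_zero ha, fun i hi => ?_⟩
        rw [h i hi]
        field_simp
        ring
      trans := by
        rintro x y z ⟨a, b, ha, h⟩ ⟨a', b', ha', h'⟩
        refine ⟨a' * a, a' * b + b', mul_ne_zero ha' ha, fun i hi => ?_⟩
        rw [h' i hi, h i hi]
        ring }

/-- The real projective space `ℙ(𝔥 / V_S^⊥)`, with its quotient topology. -/
def Line (S : Set ι) : Type := Quotient (lineSetoid S)

instance (S : Set ι) : TopologicalSpace (Line S) :=
  inferInstanceAs (TopologicalSpace (Quotient (lineSetoid S)))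

/-- The class of a vector that is not constant on `S`. -/
def Line.mk (S : Set ι) (x : ι → ℝ) (hx : NonconstOn S x) : Line S :=
  Quotient.mk (lineSetoid S) ⟨x, hx⟩

/-- The product of the projective spaces `ℙ(𝔥 / V_S^⊥)` over all `S` with at least 2 elements. -/
abbrev LineProd (ι : Type) : Type := ∀ S : {S : Set ι // S.Nontrivial}, Line S.1

theorem nonconstOn_of_injective {S : Set ι} (hS : S.Nontrivial) {x : ι → ℝ}
    (hx : Function.Injective x) : NonconstOn S x := by
  obtain ⟨i, hi, j, hj, hij⟩ := hS
  exact ⟨i, hi, j, hj, fun h => hij (hx h)⟩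

/-- The point of the product of projective spaces defined by a configuration of distinct real
numbers. -/
def conf (x : ι → ℝ) (hx : Function.Injective x) : LineProd ι :=
  fun S => Line.mk S.1 x (nonconstOn_of_injective S.2 hx)

/-- The points of the product which come from configurations of distinct points. -/
def confSet (ι : Type) : Set (LineProd ι) := {L | ∃ x hx, L = conf x hx}

/-- The real moduli space of stable genus 0 curves with marked points indexed by `ι` and one more
marked point. It is a point if `ι` has one element. -/
def M (ι : Type) : Type := {L : LineProd ι // L ∈ closure (confSet ι)}

instance : TopologicalSpace (M ι) :=
  inferInstanceAs (TopologicalSpace {L : LineProd ι // L ∈ closure (confSet ι)})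

/-- The non-negative part of the moduli space of curves with `n + 1` marked points: the closure
of the image of the open dominant Weyl chamber `x 0 > x 1 > ⋯ > x (n - 1)`. -/
def positivePart (n : ℕ) : Set (M (Fin n)) :=
  closure {L | ∃ (x : Fin n → ℝ) (hx : StrictAnti x), L.1 = conf x hx.injective}

/-- Pulling back vectors along a map of index sets. -/
def Line.pull (f : κ → ι) (S : Set κ) : Line (f '' S) → Line S :=
  Quotient.map'
    (fun x => ⟨x.1 ∘ f, by
      obtain ⟨_, ⟨i, hi, rfl⟩, _, ⟨j, hj, rfl⟩, h⟩ := x.2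
      exact ⟨i, hi, j, hj, h⟩⟩)
    (by
      rintro x y ⟨a, b, ha, h⟩
      exact ⟨a, b, ha, fun i hi => h (f i) ⟨i, hi, rfl⟩⟩)

/-- Pushing vectors forward along an injection `g`, for a set `S` in the image of `g`; the
coordinates outside the image do not matter and are set to `0`. -/
noncomputable def Line.push (g : κ → ι) (hg : Function.Injective g) (S : Set ι)
    (hS : S ⊆ Set.range g) : Line (g ⁻¹' S) → Line S :=
  Quotient.map'
    (fun y => ⟨Function.extend g y.1 0, by
      obtain ⟨i, hi, j, hj, h⟩ := y.2
      exact ⟨g i, hi, g j, hj, by rwa [hg.extend_apply, hg.extend_apply]⟩⟩)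
    (by
      rintro x y ⟨a, b, ha, h⟩
      refine ⟨a, b, ha, fun i hi => ?_⟩
      obtain ⟨c, rfl⟩ := hS hi
      simpa only [hg.extend_apply] using h c hi)

theorem Line.continuous_mk (S : Set ι) :
    Continuous (fun x : {x : ι → ℝ // NonconstOn S x} => Line.mk S x.1 x.2) :=
  continuous_quotient_mk'

theorem Line.continuous_pull (f : κ → ι) (S : Set κ) : Continuous (Line.pull f S) := by
  refine Continuous.quotient_map' ?_ _
  refine Continuous.subtype_mk ?_ _
  exact continuous_pi fun i => (continuous_apply (f i)).comp continuous_subtype_val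

theorem Line.continuous_push (g : κ → ι) (hg : Function.Injective g) (S : Set ι)
    (hS : S ⊆ Set.range g) : Continuous (Line.push g hg S hS) := by
  refine Continuous.quotient_map' ?_ _
  refine Continuous.subtype_mk ?_ _
  refine continuous_pi fun i => ?_
  by_cases h : ∃ c, g c = i
  · obtain ⟨c, rfl⟩ := h
    simp only [hg.extend_apply]
    exact (continuous_apply c).comp continuous_subtype_val
  · simp only [Function.extend_apply' _ _ _ h]
    exact continuous_const

/-- Relabelling the marked points: the point labelled `i` becomes the point labelled `e i`. -/
def relabelRaw (e : ι ≃ κ) (L : LineProd ι) : LineProd κ :=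
  fun S => Line.pull e.symm S.1 (L ⟨e.symm '' S.1, S.2.image e.symm.injective⟩)

theorem relabelRaw_mem (e : ι ≃ κ) {L : LineProd ι} (hL : L ∈ closure (confSet ι)) :
    relabelRaw e L ∈ closure (confSet κ) := by
  refine map_mem_closure (f := relabelRaw e) ?_ hL ?_
  · exact continuous_pi fun S => (Line.continuous_pull _ _).comp (continuous_apply _)
  · rintro _ ⟨x, hx, rfl⟩
    exact ⟨x ∘ e.symm, hx.comp e.symm.injective, rfl⟩

/-- Relabelling the marked points: the point labelled `i` becomes the point labelled `e i`. -/
def relabel (e : ι ≃ κ) (L : M ι) : M κ := ⟨relabelRaw e L.1, relabelRaw_mem e L.2⟩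

section Glue

variable {J : Type} {K : ι → Type}

theorem blockIncl_injective (e : (Σ i, K i) ≃ J) (i : ι) :
    Function.Injective (fun a : K i => e ⟨i, a⟩) :=
  e.injective.comp sigma_mk_injective

theorem subset_block (e : (Σ i, K i) ≃ J) {S : Set J}
    (h : ¬ ((fun j => (e.symm j).1) '' S).Nontrivial) {j₀ : J} (hj₀ : j₀ ∈ S) :
    S ⊆ Set.range (fun a : K (e.symm j₀).1 => e ⟨(e.symm j₀).1, a⟩) := by
  rw [Set.not_nontrivial_iff] at h
  intro j hj
  have hij : (e.symm j).1 = (e.symm j₀).1 := h ⟨j, hj, rfl⟩ ⟨j₀, hj₀, rfl⟩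
  rw [← hij]
  exact ⟨(e.symm j).2, e.apply_symm_apply j⟩

theorem nontrivial_preimage {g : κ → J} {S : Set J} (hS : S.Nontrivial) (h : S ⊆ Set.range g) :
    (g ⁻¹' S).Nontrivial := by
  obtain ⟨i, hi, j, hj, hij⟩ := hS
  obtain ⟨a, rfl⟩ := h hi
  obtain ⟨b, rfl⟩ := h hj
  exact ⟨a, hi, b, hj, fun hab => hij (congrArg g hab)⟩

open Classical in
/-- Gluing, in coordinates. The points labelled by `J` are divided into blocks, block `i` being
the set of points on the curve that is attached at the marked point `i`. If `S` meets at least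
two blocks, the component of the glued curve which separates `S` belongs to the first curve;
if `S` lies in one block, it belongs to the curve attached there. -/
noncomputable def glueRaw (e : (Σ i, K i) ≃ J) (L : LineProd ι) (L' : ∀ i, LineProd (K i)) :
    LineProd J :=
  fun S =>
    if h : ((fun j => (e.symm j).1) '' S.1).Nontrivial then
      Line.pull (fun j => (e.symm j).1) S.1 (L ⟨_, h⟩)
    else
      Line.push (fun a => e ⟨(e.symm S.2.nonempty.some).1, a⟩) (blockIncl_injective e _) S.1
        (subset_block e h S.2.nonempty.some_mem)
        (L' _ ⟨_, nontrivial_preimage S.2 (subset_block e h S.2.nonempty.some_mem)⟩)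

theorem continuous_glueRaw (e : (Σ i, K i) ≃ J) :
    Continuous (fun p : LineProd ι × (∀ i, LineProd (K i)) => glueRaw e p.1 p.2) := by
  refine continuous_pi fun S => ?_
  by_cases h : ((fun j => (e.symm j).1) '' S.1).Nontrivial
  · simp only [glueRaw, dif_pos h]
    exact (Line.continuous_pull _ _).comp ((continuous_apply _).comp continuous_fst)
  · simp only [glueRaw, dif_neg h]
    exact (Line.continuous_push _ _ _ _).comp
      ((continuous_apply _).comp ((continuous_apply _).comp continuous_snd))

/-- The configuration on `J` in which block `i` is concentrated near `u i` and has the shape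
`v i`, scaled by `t`. -/
def cluster (e : (Σ i, K i) ≃ J) (u : ι → ℝ) (v : ∀ i, K i → ℝ) (t : ℝ) (j : J) : ℝ :=
  u (e.symm j).1 + t * v (e.symm j).1 (e.symm j).2

theorem cluster_apply (e : (Σ i, K i) ≃ J) (u : ι → ℝ) (v : ∀ i, K i → ℝ) (t : ℝ) (i : ι)
    (a : K i) : cluster e u v t (e ⟨i, a⟩) = u i + t * v i a := by
  have h : ∀ p : Σ i, K i, p = ⟨i, a⟩ → u p.1 + t * v p.1 p.2 = u i + t * v i a := by
    rintro _ rfl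
    rfl
  exact h _ (e.symm_apply_apply _)

theorem eventually_injective_cluster [Finite J] (e : (Σ i, K i) ≃ J) {u : ι → ℝ}
    {v : ∀ i, K i → ℝ} (hu : Function.Injective u) (hv : ∀ i, Function.Injective (v i)) :
    ∀ᶠ t in 𝓝[≠] (0 : ℝ), Function.Injective (cluster e u v t) := by
  have key : ∀ p q : Σ i, K i, ∀ᶠ t in 𝓝[≠] (0 : ℝ),
      u p.1 + t * v p.1 p.2 = u q.1 + t * v q.1 q.2 → p = q := by
    rintro ⟨i, a⟩ ⟨i', a'⟩
    by_cases hi : i = i'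
    · subst hi
      filter_upwards [self_mem_nhdsWithin] with t ht h
      have h' : t * v i a = t * v i a' := by simpa using h
      rw [hv i (mul_left_cancel₀ ht h')]
    · have hc : ContinuousAt (fun t : ℝ => (u i + t * v i a) - (u i' + t * v i' a')) 0 := by
        fun_prop
      have hne := hc.eventually_ne (y := 0) (by simpa [sub_eq_zero] using fun h => hi (hu h))
      filter_upwards [hne.filter_mono nhdsWithin_le_nhds] with t ht h
      exact absurd (sub_eq_zero.2 h) ht
  have hfin : ∀ᶠ t in 𝓝[≠] (0 : ℝ), ∀ j j' : J,
      cluster e u v t j = cluster e u v t j' → e.symm j = e.symm j' :=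
    Filter.eventually_all.2 fun j => Filter.eventually_all.2 fun j' => key _ _
  filter_upwards [hfin] with t ht j j' h
  exact e.symm.injective (ht j j' h)

theorem isOpen_nonconstOn (S : Set ι) : IsOpen {x : ι → ℝ | NonconstOn S x} := by
  have : {x : ι → ℝ | NonconstOn S x} = ⋃ i ∈ S, ⋃ j ∈ S, {x | x i ≠ x j} := by
    ext x
    simp [NonconstOn]
  rw [this]
  exact isOpen_biUnion fun i _ => isOpen_biUnion fun j _ =>
    isOpen_ne_fun (continuous_apply i) (continuous_apply j)

theorem glueRaw_conf_mem [Finite J] (e : (Σ i, K i) ≃ J) {u : ι → ℝ} {v : ∀ i, K i → ℝ}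
    (hu : Function.Injective u) (hv : ∀ i, Function.Injective (v i)) :
    glueRaw e (conf u hu) (fun i => conf (v i) (hv i)) ∈ closure (confSet J) := by
  classical
  set G := glueRaw e (conf u hu) (fun i => conf (v i) (hv i)) with hG
  let Φ : ℝ → LineProd J := fun t S =>
    if h : NonconstOn S.1 (cluster e u v t) then Line.mk S.1 _ h else G S
  have hcl : Continuous (cluster e u v) := by
    unfold cluster
    fun_prop
  have hinj := eventually_injective_cluster e hu hv
  refine mem_closure_of_tendsto (f := Φ) (b := 𝓝[≠] (0 : ℝ)) ?_ ?_
  · refine tendsto_pi_nhds.2 fun S => ?_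
    by_cases h : ((fun j => (e.symm j).1) '' S.1).Nontrivial
    · have h0 : NonconstOn S.1 (cluster e u v 0) := by
        obtain ⟨_, ⟨i, hi, rfl⟩, _, ⟨j, hj, rfl⟩, hij⟩ := h
        exact ⟨i, hi, j, hj, by simpa [cluster] using fun h => hij (hu h)⟩
      have hGS : G S = Line.mk S.1 _ h0 := by
        simp only [hG, glueRaw, dif_pos h]
        refine Quotient.sound' ⟨1, 0, one_ne_zero, fun i _ => ?_⟩
        simp [cluster]
      have hΦ0 : Φ 0 S = G S := by simp only [Φ, dif_pos h0, hGS]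
      rw [← hΦ0]
      have hcont : ContinuousOn (fun t => Φ t S) {t | NonconstOn S.1 (cluster e u v t)} := by
        rw [continuousOn_iff_continuous_domRestrict]
        have : Continuous (fun t : {t | NonconstOn S.1 (cluster e u v t)} =>
            Line.mk S.1 (cluster e u v t.1) t.2) :=
          (Line.continuous_mk S.1).comp
            (Continuous.subtype_mk (hcl.comp continuous_subtype_val) fun t => t.2)
        refine this.congr fun t => ?_
        simp only [Set.domRestrict_apply, Φ]
        exact (dif_pos (c := NonconstOn S.1 (cluster e u v t.1)) t.2).symm
      exact (hcont.continuousAt (((isOpen_nonconstOn S.1).preimage hcl).mem_nhds h0)).tendsto.mono_left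
        nhdsWithin_le_nhds
    · refine tendsto_const_nhds.congr' ?_
      filter_upwards [hinj, self_mem_nhdsWithin] with t ht ht0
      have hn : NonconstOn S.1 (cluster e u v t) := nonconstOn_of_injective S.2 ht
      have ht0 : t ≠ 0 := ht0
      simp only [Φ, dif_pos hn]
      simp only [hG, glueRaw, dif_neg h]
      refine Quotient.sound' ⟨t, u (e.symm S.2.nonempty.some).1, ht0, fun j hj => ?_⟩
      obtain ⟨a, rfl⟩ := subset_block e h S.2.nonempty.some_mem hj
      dsimp only
      rw [(blockIncl_injective e (e.symm S.2.nonempty.some).1).extend_apply]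
      rw [cluster_apply, add_comm]
  · filter_upwards [hinj] with t ht
    refine ⟨_, ht, funext fun S => ?_⟩
    simp only [Φ, dif_pos (nonconstOn_of_injective S.2 ht), conf]

theorem glueRaw_mem [Finite J] (e : (Σ i, K i) ≃ J) {L : LineProd ι} {L' : ∀ i, LineProd (K i)}
    (hL : L ∈ closure (confSet ι)) (hL' : ∀ i, L' i ∈ closure (confSet (K i))) :
    glueRaw e L L' ∈ closure (confSet J) := by
  have hmem : (L, L') ∈ closure (confSet ι ×ˢ Set.pi Set.univ fun i => confSet (K i)) := by
    rw [closure_prod_eq, closure_pi_set]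
    exact ⟨hL, fun i _ => hL' i⟩
  rw [← closure_closure]
  refine map_mem_closure (f := fun p : LineProd ι × (∀ i, LineProd (K i)) => glueRaw e p.1 p.2)
    (continuous_glueRaw e) hmem ?_
  rintro ⟨_, M'⟩ ⟨⟨u, hu, rfl⟩, hM'⟩
  choose v hv hvM using fun i => hM' i (Set.mem_univ i)
  obtain rfl : M' = fun i => conf (v i) (hv i) := funext hvM
  exact glueRaw_conf_mem e hu hv

/-- Attaching the curves `C' i` to the curve `C`: the last marked point of `C' i` is glued to
the marked point `i` of `C`; the marked points of the glued curve are labelled through `e`. -/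
noncomputable def glue [Finite J] (e : (Σ i, K i) ≃ J) (C : M ι) (C' : ∀ i, M (K i)) : M J :=
  ⟨glueRaw e C.1 fun i => (C' i).1, glueRaw_mem e C.2 fun i => (C' i).2⟩

end Glue

end Moduli

/-! ## Coloured operadic coverings -/

/-- The identification of the points of `n` consecutive blocks of sizes `k 0, …, k (n - 1)`,
in lexicographic order, with `0, …, N - 1`, where `N` is the sum of the `k i`. -/
def blockEquiv {n N : ℕ} {k : Fin n → ℕ} (h : ∑ i, k i = N) : (Σ i, Fin (k i)) ≃ Fin N :=
  finSigmaFinEquiv.trans (finCongr h)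

/-- The operad structure of the symmetric groups: the permutation which moves block `i` to
position `w i` and acts inside this block by `v i`. -/
def blockPerm {n N : ℕ} {k : Fin n → ℕ} (h : ∑ i, k i = N) (w : Equiv.Perm (Fin n))
    (h' : ∑ j, k (w.symm j) = N) (v : ∀ i, Equiv.Perm (Fin (k i))) : Equiv.Perm (Fin N) :=
  (blockEquiv h).symm.trans ((Equiv.sigmaCongrRight v).trans
    ((Equiv.sigmaCongrLeft (β := fun i => Fin (k i)) w.symm).symm.trans (blockEquiv h')))

/-- A sequence of `Ξ`-coloured covering spaces `X n` of the moduli spaces `M (Fin n)` of curves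
with `n + 1` marked points, `n ≥ 1`, with compatible actions of the symmetric groups. The points
of `X n` have `n` input colours and one output colour; `Ξ` is meant to be discrete.
(`X 0` plays no role.) -/
structure ColouredCovering (Ξ : Type u) [TopologicalSpace Ξ] where
  X : ℕ → Type u
  [top : ∀ n, TopologicalSpace (X n)]
  [act : ∀ n, MulAction (Equiv.Perm (Fin n)) (X n)]
  pt : ∀ {n : ℕ}, X n → M (Fin n)
  inp : ∀ {n : ℕ}, X n → Fin n → Ξ
  out : ∀ {n : ℕ}, X n → Ξ
  isCoveringMap : ∀ n, 0 < n →
    IsCoveringMap (fun x : X n => ((pt x, inp x, out x) : M (Fin n) × (Fin n → Ξ) × Ξ))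
  continuous_smul : ∀ n, 0 < n → ∀ w : Equiv.Perm (Fin n), Continuous (fun x : X n => w • x)
  pt_smul : ∀ {n : ℕ}, 0 < n → ∀ (w : Equiv.Perm (Fin n)) (x : X n), pt (w • x) = relabel w (pt x)
  inp_smul : ∀ {n : ℕ}, 0 < n → ∀ (w : Equiv.Perm (Fin n)) (x : X n) (i : Fin n),
    inp (w • x) (w i) = inp x i
  out_smul : ∀ {n : ℕ}, 0 < n → ∀ (w : Equiv.Perm (Fin n)) (x : X n), out (w • x) = out x

attribute [instance] ColouredCovering.top ColouredCovering.act

namespace ColouredCovering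

variable {Ξ : Type u} [TopologicalSpace Ξ]

/-- `y 0, …, y (n - 1)` can be plugged into `x`: all arities are positive, and the output colour
of `y i` is the input colour of `x` at `i`. -/
structure Composable (P : ColouredCovering Ξ) {n : ℕ} {k : Fin n → ℕ} (x : P.X n)
    (y : ∀ i, P.X (k i)) : Prop where
  pos : 0 < n
  pos_block : ∀ i, 0 < k i
  colour : ∀ i, P.out (y i) = P.inp x i

/-- The part `X(l)^m` of `X n` with input colours `l` and output colour `m`. -/
abbrev Fibre (P : ColouredCovering Ξ) {n : ℕ} (l : Fin n → Ξ) (m : Ξ) : Type u :=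
  {x : P.X n // P.inp x = l ∧ P.out x = m}

end ColouredCovering

/-- A `Ξ`-coloured operadic covering of the real moduli spaces of genus 0 curves. In the axioms,
the hypotheses `h₁`, `h₂` only say that the composites make sense; they are automatic. -/
structure OperadicCovering (Ξ : Type u) [TopologicalSpace Ξ] extends ColouredCovering Ξ where
  /-- Operadic composition. -/
  Γ : ∀ {n N : ℕ} {k : Fin n → ℕ} (_ : ∑ i, k i = N) (x : X n) (y : ∀ i, X (k i)),
    toColouredCovering.Composable x y → X N
  continuous_Γ : ∀ {n N : ℕ} {k : Fin n → ℕ} (h : ∑ i, k i = N),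
    Continuous (fun p : {p : X n × (∀ i, X (k i)) // toColouredCovering.Composable p.1 p.2} =>
      Γ h p.1.1 p.1.2 p.2)
  inp_Γ : ∀ {n N : ℕ} {k : Fin n → ℕ} (h : ∑ i, k i = N) (x : X n) (y : ∀ i, X (k i))
    (hxy : toColouredCovering.Composable x y) (i : Fin n) (a : Fin (k i)),
    inp (Γ h x y hxy) (blockEquiv h ⟨i, a⟩) = inp (y i) a
  out_Γ : ∀ {n N : ℕ} {k : Fin n → ℕ} (h : ∑ i, k i = N) (x : X n) (y : ∀ i, X (k i))
    (hxy : toColouredCovering.Composable x y), out (Γ h x y hxy) = out x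
  /-- The composition covers the gluing of curves. -/
  pt_Γ : ∀ {n N : ℕ} {k : Fin n → ℕ} (h : ∑ i, k i = N) (x : X n) (y : ∀ i, X (k i))
    (hxy : toColouredCovering.Composable x y),
    pt (Γ h x y hxy) = glue (blockEquiv h) (pt x) (fun i => pt (y i))
  /-- Unit axiom: `X(l)^m` is a point if `l = m`, and empty otherwise. -/
  one : Ξ → X 1
  inp_one : ∀ l i, inp (one l) i = l
  out_one : ∀ l, out (one l) = l
  eq_one : ∀ x : X 1, x = one (out x)
  one_Γ : ∀ {n : ℕ} (y : X n) (h : ∑ _i : Fin 1, n = n)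
    (h₁ : toColouredCovering.Composable (one (out y)) (fun _ : Fin 1 => y)),
    Γ h (one (out y)) (fun _ => y) h₁ = y
  Γ_one : ∀ {n : ℕ} (x : X n) (h : ∑ _i : Fin n, 1 = n)
    (h₁ : toColouredCovering.Composable x (fun i => one (inp x i))),
    Γ h x (fun i => one (inp x i)) h₁ = x
  /-- Associativity axiom. -/
  Γ_assoc : ∀ {n m N : ℕ} {k : Fin n → ℕ} {r : ∀ i, Fin (k i) → ℕ} {s : Fin n → ℕ}
    (h : ∑ i, k i = m)
    (h' : ∑ p, r ((blockEquiv h).symm p).1 ((blockEquiv h).symm p).2 = N)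
    (hs : ∀ i, ∑ j, r i j = s i) (hs' : ∑ i, s i = N)
    (x : X n) (y : ∀ i, X (k i)) (z : ∀ i j, X (r i j))
    (hxy : toColouredCovering.Composable x y)
    (hyz : ∀ i, toColouredCovering.Composable (y i) (z i))
    (h₁ : toColouredCovering.Composable (Γ h x y hxy)
      (fun p => z ((blockEquiv h).symm p).1 ((blockEquiv h).symm p).2))
    (h₂ : toColouredCovering.Composable x (fun i => Γ (hs i) (y i) (z i) (hyz i))),
    Γ h' (Γ h x y hxy) (fun p => z ((blockEquiv h).symm p).1 ((blockEquiv h).symm p).2) h₁ =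
      Γ hs' x (fun i => Γ (hs i) (y i) (z i) (hyz i)) h₂
  /-- Equivariance axiom. -/
  Γ_smul : ∀ {n N : ℕ} {k : Fin n → ℕ} (h : ∑ i, k i = N) (w : Equiv.Perm (Fin n))
    (h' : ∑ j, k (w.symm j) = N) (v : ∀ i, Equiv.Perm (Fin (k i)))
    (x : X n) (y : ∀ i, X (k i)) (hxy : toColouredCovering.Composable x y)
    (h₁ : toColouredCovering.Composable (w • x) (fun j => v (w.symm j) • y (w.symm j))),
    Γ h' (w • x) (fun j => v (w.symm j) • y (w.symm j)) h₁ = blockPerm h w h' v • Γ h x y hxy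
  /-- Composition is a bijection onto the restriction of `X N` to the boundary stratum. -/
  Γ_injective : ∀ {n N : ℕ} {k : Fin n → ℕ} (h : ∑ i, k i = N) (x x' : X n)
    (y y' : ∀ i, X (k i)) (hxy : toColouredCovering.Composable x y)
    (hxy' : toColouredCovering.Composable x' y'),
    Γ h x y hxy = Γ h x' y' hxy' → x = x' ∧ y = y'
  Γ_surjective : ∀ {n N : ℕ} {k : Fin n → ℕ} (h : ∑ i, k i = N), 0 < n → (∀ i, 0 < k i) →
    ∀ z : X N, (∃ (C : M (Fin n)) (C' : ∀ i, M (Fin (k i))), pt z = glue (blockEquiv h) C C') →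
      ∃ x y hxy, Γ h x y hxy = z

/-! ## Coboundary categories and graded sets -/

/-- A category with tensor product `T` is a coboundary category: it has an associator and a
commutor, natural isomorphisms satisfying the pentagon, symmetry and hexagon axioms.
(No unit object is required.) -/
@[ext]
structure CoboundaryStructure {C : Type*} [Category C] (T : C × C ⥤ C) where
  assoc (A B D : C) : T.obj (T.obj (A, B), D) ≅ T.obj (A, T.obj (B, D))
  assoc_naturality : ∀ {A A' B B' D D' : C} (f : A ⟶ A') (g : B ⟶ B') (h : D ⟶ D'),
    T.map (T.map (f ×ₘ g) ×ₘ h) ≫ (assoc A' B' D').hom =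
      (assoc A B D).hom ≫ T.map (f ×ₘ T.map (g ×ₘ h))
  pentagon : ∀ A B D E : C,
    T.map ((assoc A B D).hom ×ₘ 𝟙 E) ≫ (assoc A (T.obj (B, D)) E).hom ≫
        T.map (𝟙 A ×ₘ (assoc B D E).hom) =
      (assoc (T.obj (A, B)) D E).hom ≫ (assoc A B (T.obj (D, E))).hom
  comm (A B : C) : T.obj (A, B) ≅ T.obj (B, A)
  comm_naturality : ∀ {A A' B B' : C} (f : A ⟶ A') (g : B ⟶ B'),
    T.map (f ×ₘ g) ≫ (comm A' B').hom = (comm A B).hom ≫ T.map (g ×ₘ f)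
  comm_comm : ∀ A B : C, (comm A B).hom ≫ (comm B A).hom = 𝟙 (T.obj (A, B))
  hexagon : ∀ A B D : C,
    (assoc A B D).hom ≫ (comm A (T.obj (B, D))).hom ≫ T.map ((comm B D).hom ×ₘ 𝟙 A) =
      (comm (T.obj (A, B)) D).hom ≫ T.map (𝟙 D ×ₘ (comm A B).hom) ≫ (assoc D B A).inv

/-- A `Ξ`-graded set: a family of finite sets, only finitely many of them non-empty. -/
structure GradedSet (Ξ : Type u) where
  obj : Ξ → Type u
  finite_obj : ∀ l, Finite (obj l)
  finite_support : {l | Nonempty (obj l)}.Finite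

instance (Ξ : Type u) : Category.{u} (GradedSet Ξ) where
  Hom A B := ∀ l, A.obj l → B.obj l
  id _ := fun _ a => a
  comp f g := fun l a => g l (f l a)

theorem GradedSet.finite_sigma {Ξ : Type u} (A : GradedSet Ξ) : Finite (Σ l, A.obj l) := by
  have := A.finite_obj
  have : Finite {l // Nonempty (A.obj l)} := A.finite_support
  exact Finite.of_injective
    (fun p : Σ l, A.obj l => (⟨⟨p.1, ⟨p.2⟩⟩, p.2⟩ : Σ l : {l // Nonempty (A.obj l)}, A.obj l.1))
    (by
      rintro ⟨l, a⟩ ⟨l', a'⟩ h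
      simp only [Sigma.mk.injEq, Subtype.mk.injEq] at h
      obtain ⟨rfl, h⟩ := h
      rw [eq_of_heq h])

namespace OperadicCovering

variable {Ξ : Type u} [TopologicalSpace Ξ]

/-- For any two colours there are only finitely many points of `X 2` with these input colours,
that is, all `X(l₁, l₂)^m` are finite and only finitely many of them, for fixed `l₁` and `l₂`,
are non-empty. This is what it takes for the tensor product of graded sets to be defined. -/
def FiniteMultiplicities (P : OperadicCovering Ξ) : Prop :=
  ∀ l₁ l₂ : Ξ, {x : P.X 2 | P.inp x = ![l₁, l₂]}.Finite

/-- The sets `(A ⊗ B)_m`: the disjoint union of `X(l₁, l₂)^m × A_{l₁} × B_{l₂}` over all pairs of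
colours `l₁`, `l₂`. -/
abbrev TensorElt (P : OperadicCovering Ξ) (A B : Ξ → Type u) (m : Ξ) : Type u :=
  Σ l : Ξ × Ξ, P.Fibre ![l.1, l.2] m × A l.1 × B l.2

theorem finite_sigma_tensorElt (P : OperadicCovering Ξ) (hP : P.FiniteMultiplicities)
    (A B : GradedSet Ξ) : Finite (Σ m, P.TensorElt A.obj B.obj m) := by
  have := A.finite_sigma
  have := B.finite_sigma
  have : ∀ l₁ l₂, Finite {x : P.X 2 // P.inp x = ![l₁, l₂]} := hP
  refine Finite.of_injective
    (fun t => (⟨(⟨t.2.1.1, t.2.2.2.1⟩, ⟨t.2.1.2, t.2.2.2.2⟩), ⟨t.2.2.1.1, t.2.2.1.2.1⟩⟩ :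
      Σ q : (Σ l, A.obj l) × (Σ l, B.obj l), {x : P.X 2 // P.inp x = ![q.1.1, q.2.1]})) ?_
  rintro ⟨m, ⟨l₁, l₂⟩, ⟨x, hx, rfl⟩, a, b⟩ ⟨m', ⟨l₁', l₂'⟩, ⟨x', hx', rfl⟩, a', b'⟩ h
  simp only [Sigma.mk.injEq, Prod.mk.injEq] at h
  obtain ⟨⟨⟨rfl, h1⟩, ⟨rfl, h2⟩⟩, h3⟩ := h
  obtain rfl := eq_of_heq h1
  obtain rfl := eq_of_heq h2
  obtain rfl : x = x' := congrArg Subtype.val (eq_of_heq h3)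
  rfl

/-- The tensor product of graded sets. -/
def tensorObj (P : OperadicCovering Ξ) (hP : P.FiniteMultiplicities) (A B : GradedSet Ξ) :
    GradedSet Ξ where
  obj m := P.TensorElt A.obj B.obj m
  finite_obj m := by
    have := P.finite_sigma_tensorElt hP A B
    exact Finite.of_injective (Sigma.mk (β := fun m => P.TensorElt A.obj B.obj m) m)
      sigma_mk_injective
  finite_support := by
    have := P.finite_sigma_tensorElt hP A B
    refine (Set.finite_range (fun t : Σ m, P.TensorElt A.obj B.obj m => t.1)).subset ?_
    rintro m ⟨t⟩
    exact ⟨⟨m, t⟩, rfl⟩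

/-- The tensor product bifunctor on graded sets. -/
def tensor (P : OperadicCovering Ξ) (hP : P.FiniteMultiplicities) :
    GradedSet Ξ × GradedSet Ξ ⥤ GradedSet Ξ where
  obj A := P.tensorObj hP A.1 A.2
  map f := fun _ t => ⟨t.1, t.2.1, f.1 _ t.2.2.1, f.2 _ t.2.2.2⟩
  map_id _ := rfl
  map_comp _ _ := rfl

/-- The composition of `x` and `y` at the first input of `x`. -/
def compLeft (P : OperadicCovering Ξ) (x y : P.X 2) (h : P.out y = P.inp x 0) : P.X 3 :=
  P.Γ (k := ![2, 1]) rfl x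
    (fun i => match i with
      | 0 => y
      | 1 => P.one (P.inp x 1))
    ⟨by decide, by decide, fun i => match i with
      | 0 => h
      | 1 => P.out_one _⟩

/-- The composition of `x` and `y` at the second input of `x`. -/
def compRight (P : OperadicCovering Ξ) (x y : P.X 2) (h : P.out y = P.inp x 1) : P.X 3 :=
  P.Γ (k := ![1, 2]) rfl x
    (fun i => match i with
      | 0 => P.one (P.inp x 0)
      | 1 => y)
    ⟨by decide, by decide, fun i => match i with
      | 0 => P.out_one _
      | 1 => h⟩

/-- The point of the covering over `(12)3` that corresponds to an element of
`((A ⊗ B) ⊗ D)_m`. -/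
def leftPoint (P : OperadicCovering Ξ) {A B D : Ξ → Type u} {m : Ξ}
    (t : P.TensorElt (P.TensorElt A B) D m) : P.X 3 :=
  P.compLeft t.2.1.1 t.2.2.1.2.1.1 (by rw [t.2.2.1.2.1.2.2, t.2.1.2.1]; rfl)

/-- The point of the covering over `1(23)` that corresponds to an element of
`(A ⊗ (B ⊗ D))_m`. -/
def rightPoint (P : OperadicCovering Ξ) {A B D : Ξ → Type u} {m : Ξ}
    (t : P.TensorElt A (P.TensorElt B D) m) : P.X 3 :=
  P.compRight t.2.1.1 t.2.2.2.2.1.1 (by rw [t.2.2.2.2.1.2.2, t.2.1.2.1]; rfl)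

end OperadicCovering

/-- The curve with one component and the marked points `0, -1, …, 1 - n` and `∞`. For `n ≤ 2`
it is the only point of the moduli space. -/
noncomputable def stdCurve (n : ℕ) : M (Fin n) :=
  ⟨conf (fun i => -(i : ℝ)) (fun i j h => by simpa [Fin.ext_iff] using h),
    subset_closure ⟨_, _, rfl⟩⟩

/-- The point `(12)3` of the moduli space of curves with 4 marked points. -/
noncomputable def pt12_3 : M (Fin 3) :=
  glue (blockEquiv (k := ![2, 1]) rfl) (stdCurve 2) (fun i => stdCurve (![2, 1] i))

/-- The point `1(23)` of the moduli space of curves with 4 marked points. -/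
noncomputable def pt1_23 : M (Fin 3) :=
  glue (blockEquiv (k := ![1, 2]) rfl) (stdCurve 2) (fun i => stdCurve (![1, 2] i))

namespace OperadicCovering

variable {Ξ : Type u} [TopologicalSpace Ξ]

/-- `z'` is the image of `z` under the monodromy of the covering along the path `p`. -/
def IsMonodromy (P : OperadicCovering Ξ) {n : ℕ} {c c' : M (Fin n)} (p : Path c c')
    (z z' : P.X n) : Prop :=
  ∃ q : Path z z', ∀ s, P.pt (q s) = p s

/-- `f` is the associator: it keeps the elements of `A`, `B` and `D`, and it acts on the points of
the covering by the monodromy along the paths from `(12)3` to `1(23)` in the non-negative part of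
the moduli space. -/
def IsAssociator (P : OperadicCovering Ξ) (hP : P.FiniteMultiplicities) {A B D : GradedSet Ξ}
    (f : P.tensorObj hP (P.tensorObj hP A B) D ⟶ P.tensorObj hP A (P.tensorObj hP B D)) : Prop :=
  ∀ (m : Ξ) (t : P.TensorElt (P.TensorElt A.obj B.obj) D.obj m),
    let t' : P.TensorElt A.obj (P.TensorElt B.obj D.obj) m := f m t
    (⟨t'.1.1, t'.2.2.1⟩ : Σ l, A.obj l) = ⟨t.2.2.1.1.1, t.2.2.1.2.2.1⟩ ∧
    (⟨t'.2.2.2.1.1, t'.2.2.2.2.2.1⟩ : Σ l, B.obj l) = ⟨t.2.2.1.1.2, t.2.2.1.2.2.2⟩ ∧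
    (⟨t'.2.2.2.1.2, t'.2.2.2.2.2.2⟩ : Σ l, D.obj l) = ⟨t.1.2, t.2.2.2⟩ ∧
    ∀ p : Path pt12_3 pt1_23, (∀ s, p s ∈ positivePart 3) →
      P.IsMonodromy p (P.leftPoint t) (P.rightPoint t')

/-- `f` is the commutor: it exchanges the elements of `A` and `B`, and it acts on the points of
the covering by the transposition in the symmetric group on two letters. -/
def IsCommutor (P : OperadicCovering Ξ) (hP : P.FiniteMultiplicities) {A B : GradedSet Ξ}
    (f : P.tensorObj hP A B ⟶ P.tensorObj hP B A) : Prop :=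
  ∀ (m : Ξ) (t : P.TensorElt A.obj B.obj m),
    let t' : P.TensorElt B.obj A.obj m := f m t
    (⟨t'.1.1, t'.2.2.1⟩ : Σ l, B.obj l) = ⟨t.1.2, t.2.2.2⟩ ∧
    (⟨t'.1.2, t'.2.2.2⟩ : Σ l, A.obj l) = ⟨t.1.1, t.2.2.1⟩ ∧
    t'.2.1.1 = Equiv.swap (0 : Fin 2) 1 • t.2.1.1

end OperadicCovering

end RealModuli

/-! The points that matter are described by one vector for each pair `i < j`, which gives the
coordinates at all sets with least element `i` and greatest element `j`. Neighbouring pairs carry no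
information, so a point with three labels depends on the pair `0, 2` only. The ratio `(x₀ - x₁) /
(x₀ - x₂)` then identifies the non-negative part with an interval whose ends are `(12)3` and `1(23)`
(`segmentHomeomorph`). Contractibility follows. Moreover each path in it from end to end is a
reparametrization of `segment`, so lifting that one segment (`Mono`) computes the monodromy along
all of them.

Since gluing is bijective onto the boundary strata and `X 1` consists of units, a point over an end
of the segment is a unique composition of two elements of `X 2`. Lifts preserve colours because `Ξ`
is discrete. Hence `AssocRel` matches composable pairs bijectively, which both constructs the
associator and determines it; the commutor is given by a formula. Naturality holds because morphisms
do not touch the points of the covering.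

The pentagon axiom comes from a map of a square to the non-negative part for four labels, whose
boundary runs through five families of glued curves (`pentagon_left` and its companions). The map
lifts to the covering. By uniqueness of lifts (`IsComp.transport`), each side of the lift is a
composition in which one factor undergoes `Mono`. The two routes around the boundary start and end
at the same points of the lifted square, and injectivity of `Γ` identifies the resulting factors.

The hexagon axiom is a symmetry. Reversing three labels reverses `segment` and exchanges left and
right compositions while transposing the inputs of both factors, so `AssocRel` is invariant under
transposing everything and swapping source with target (`AssocRel.swap`). -/

namespace RealModuli

open scoped unitInterval

/-! ### The moduli spaces are Hausdorff -/

section Hausdorff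

variable {ι : Type}

theorem Line.mk_eq_mk {S : Set ι} {x y : ι → ℝ} {hx : NonconstOn S x} {hy : NonconstOn S y}
    (a b : ℝ) (ha : a ≠ 0) (h : ∀ i ∈ S, y i = a * x i + b) : Line.mk S x hx = Line.mk S y hy :=
  Quotient.sound ⟨a, b, ha, h⟩

theorem Line.exists_mk_eq {S : Set ι} (l : Line S) : ∃ x hx, l = Line.mk S x hx := by
  obtain ⟨⟨x, hx⟩, rfl⟩ := Quotient.exists_rep l
  exact ⟨x, hx, rfl⟩

variable [Fintype ι]

open Classical in
/-- The sum of the squared differences of the coordinates in `S`. -/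
noncomputable def sqDiffs (S : Set ι) (x : ι → ℝ) : ℝ :=
  ∑ p : ι × ι, if p.1 ∈ S ∧ p.2 ∈ S then (x p.1 - x p.2) ^ 2 else 0

theorem sqDiffs_pos {S : Set ι} {x : ι → ℝ} (hx : NonconstOn S x) : 0 < sqDiffs S x := by
  obtain ⟨i, hi, j, hj, h⟩ := hx
  refine Finset.sum_pos' (fun p _ => by split_ifs <;> positivity) ⟨(i, j), Finset.mem_univ _, ?_⟩
  rw [if_pos ⟨hi, hj⟩]
  have := sub_ne_zero.2 h
  positivity

theorem continuous_sqDiffs (S : Set ι) : Continuous (sqDiffs S) := by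
  refine continuous_finsetSum _ fun p _ => ?_
  split_ifs <;> fun_prop

theorem sqDiffs_affine {S : Set ι} {x y : ι → ℝ} {a b : ℝ} (h : ∀ i ∈ S, y i = a * x i + b) :
    sqDiffs S y = a ^ 2 * sqDiffs S x := by
  rw [sqDiffs, sqDiffs, Finset.mul_sum]
  refine Finset.sum_congr rfl fun p _ => ?_
  split_ifs with hp
  · rw [h _ hp.1, h _ hp.2]
    ring
  · simp

/-- The normalized products of two differences of coordinates: an embedding of the projective
space into a vector space. -/
noncomputable def Line.segre (S : Set ι) : Line S → S × S × S × S → ℝ :=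
  Quotient.lift
    (fun x q => (x.1 q.1 - x.1 q.2.1) * (x.1 q.2.2.1 - x.1 q.2.2.2) / sqDiffs S x.1)
    (by
      rintro x y ⟨a, b, ha, h⟩
      funext q
      have hx := (sqDiffs_pos x.2).ne'
      rw [sqDiffs_affine h, h _ q.1.2, h _ q.2.1.2, h _ q.2.2.1.2, h _ q.2.2.2.2]
      field_simp
      ring)

theorem Line.continuous_segre (S : Set ι) : Continuous (Line.segre S) := by
  refine Continuous.quotient_lift (continuous_pi fun q => ?_) _
  refine Continuous.div ?_ ((continuous_sqDiffs S).comp continuous_subtype_val)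
    fun x => (sqDiffs_pos x.2).ne'
  have h : ∀ i, Continuous fun x : {x : ι → ℝ // NonconstOn S x} => x.1 i := fun i =>
    (continuous_apply i).comp continuous_subtype_val
  exact ((h _).sub (h _)).mul ((h _).sub (h _))

/-- Fixing `i`, `j` with `x i ≠ x j`, the values `(x k - x j) * (x i - x j)` recover all ratios `(x
k - x j) / (x i - x j)`, hence `x` on `S` up to an affine map. -/
theorem Line.segre_injective (S : Set ι) : Function.Injective (Line.segre S) := by
  intro l l' hl
  obtain ⟨x, hx, rfl⟩ := l.exists_mk_eq
  obtain ⟨y, hy, rfl⟩ := l'.exists_mk_eq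
  have hDx := sqDiffs_pos hx
  have hDy := sqDiffs_pos hy
  obtain ⟨i, hi, j, hj, hij⟩ := id hx
  have key : ∀ k ∈ S, (x k - x j) * (x i - x j) / sqDiffs S x =
      (y k - y j) * (y i - y j) / sqDiffs S y := fun k hk =>
    congrFun hl (⟨k, hk⟩, ⟨j, hj⟩, ⟨i, hi⟩, ⟨j, hj⟩)
  have hxij := sub_ne_zero.2 hij
  have hyij : y i - y j ≠ 0 := by
    intro h0
    have := key i hi
    rw [h0, mul_zero, zero_div, div_eq_zero_iff] at this
    simp_all [hDx.ne']
  have hD : sqDiffs S y = ((y i - y j) / (x i - x j)) ^ 2 * sqDiffs S x := by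
    have := key i hi
    field_simp at this ⊢
    linarith
  -- The affine map is forced by its values at `x i` and `x j`.
  refine Line.mk_eq_mk ((y i - y j) / (x i - x j)) (y j - (y i - y j) / (x i - x j) * x j)
    (div_ne_zero hyij hxij) fun k hk => ?_
  have := key k hk
  rw [hD] at this
  field_simp at this ⊢
  linarith

instance (S : Set ι) : T2Space (Line S) :=
  T2Space.of_injective_continuous (Line.segre_injective S) (Line.continuous_segre S)

instance : T2Space (M ι) :=
  inferInstanceAs (T2Space {L : LineProd ι // L ∈ closure (confSet ι)})

end Hausdorff

/-! ### Coordinates indexed by the extreme elements of a set -/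

section Hull

variable {n N : ℕ}

/-- The coordinates of `L` at all sets with least element `i` and greatest element `j` are given
by the vector `v`. -/
def RepAt (L : M (Fin n)) (i j : Fin n) (v : Fin n → ℝ) : Prop :=
  ∀ S : {S : Set (Fin n) // S.Nontrivial}, IsLeast S.1 i → IsGreatest S.1 j →
    ∃ hv, L.1 S = Line.mk S.1 v hv

theorem exists_hull (S : Set (Fin n)) (hS : S.Nontrivial) :
    ∃ i j, i < j ∧ IsLeast S i ∧ IsGreatest S j := by
  classical
  obtain ⟨i, hi, hi'⟩ := Set.exists_min_image S id S.toFinite hS.nonempty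
  obtain ⟨j, hj, hj'⟩ := Set.exists_max_image S id S.toFinite hS.nonempty
  refine ⟨i, j, lt_of_le_of_ne (hi' j hj) ?_, ⟨hi, hi'⟩, hj, hj'⟩
  rintro rfl
  exact hS.not_subsingleton fun a ha b hb =>
    (le_antisymm (hj' a ha) (hi' a ha)).trans (le_antisymm (hj' b hb) (hi' b hb)).symm

/-- Every nontrivial set has a least and a greatest element, so common vectors for all pairs cover
all coordinates. This is how points of the moduli space are compared below. -/
theorem ext_of_repAt {L L' : M (Fin n)}
    (h : ∀ i j, i < j → ∃ v, RepAt L i j v ∧ RepAt L' i j v) : L = L' := by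
  refine Subtype.ext (funext fun S => ?_)
  obtain ⟨i, j, hij, hi, hj⟩ := exists_hull S.1 S.2
  obtain ⟨v, h, h'⟩ := h i j hij
  obtain ⟨_, e⟩ := h S hi hj
  obtain ⟨_, e'⟩ := h' S hi hj
  rw [e, e']

/-- The sets in question lie between `i` and `j`, so entries outside this range may be changed
freely. -/
theorem RepAt.affine {L : M (Fin n)} {i j : Fin n} {v w : Fin n → ℝ} (h : RepAt L i j v) (a b : ℝ)
    (ha : a ≠ 0) (hvw : ∀ k, i ≤ k → k ≤ j → w k = a * v k + b) : RepAt L i j w := by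
  intro S hi hj
  obtain ⟨hv, e⟩ := h S hi hj
  have hw : ∀ k ∈ S.1, w k = a * v k + b := fun k hk => hvw k (hi.2 hk) (hj.2 hk)
  refine ⟨?_, e.trans (Line.mk_eq_mk a b ha hw)⟩
  obtain ⟨k, hk, l, hl, hkl⟩ := hv
  refine ⟨k, hk, l, hl, ?_⟩
  rw [hw k hk, hw l hl]
  simpa [ha] using hkl

theorem exists_affine {x y x' y' : ℝ} (h : x ≠ y) (h' : x' ≠ y') :
    ∃ a b, a ≠ 0 ∧ x' = a * x + b ∧ y' = a * y + b := by
  have h1 := sub_ne_zero.2 h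
  have h2 := sub_ne_zero.2 h'
  refine ⟨(x' - y') / (x - y), y' - (x' - y') / (x - y) * y, div_ne_zero h2 h1, ?_, ?_⟩
  · field_simp
    ring
  · ring

/-- If there is nothing between `i` and `j`, every vector with different coordinates at `i` and
`j` will do. -/
theorem RepAt.of_adjacent (L : M (Fin n)) {i j : Fin n} (hij : ∀ k, i ≤ k → k ≤ j → k = i ∨ k = j)
    {v : Fin n → ℝ} (hv : v i ≠ v j) : RepAt L i j v := by
  intro S hi hj
  refine ⟨⟨i, hi.1, j, hj.1, hv⟩, ?_⟩
  obtain ⟨x, hx, e⟩ := (L.1 S).exists_mk_eq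
  rw [e]
  have hS : ∀ k ∈ S.1, k = i ∨ k = j := fun k hk => hij k (hi.2 hk) (hj.2 hk)
  have hxij : x i ≠ x j := by
    obtain ⟨k, hk, l, hl, hkl⟩ := hx
    rcases hS k hk with rfl | rfl <;> rcases hS l hl with rfl | rfl
    · exact absurd rfl hkl
    · exact hkl
    · exact hkl.symm
    · exact absurd rfl hkl
  obtain ⟨a, b, ha, h1, h2⟩ := exists_affine hxij hv
  refine Line.mk_eq_mk a b ha fun k hk => ?_
  rcases hS k hk with rfl | rfl
  · exact h1
  · exact h2

theorem repAt_conf {x : Fin n → ℝ} (hx : Function.Injective x) (h) (i j : Fin n) :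
    RepAt ⟨conf x hx, h⟩ i j x := fun _ _ _ => ⟨_, rfl⟩

/-! ### Coordinates of glued curves -/

section Block

variable {k : Fin n → ℕ} (h : ∑ i, k i = N)

theorem val_blockEquiv (i : Fin n) (a : Fin (k i)) :
    (blockEquiv h ⟨i, a⟩ : ℕ) = ∑ l : Fin i, k (Fin.castLE i.2.le l) + a := by
  simp [blockEquiv, finSigmaFinEquiv_apply]

theorem blockEquiv_le_iff {i : Fin n} {a b : Fin (k i)} :
    blockEquiv h ⟨i, a⟩ ≤ blockEquiv h ⟨i, b⟩ ↔ a ≤ b := by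
  rw [Fin.le_def, val_blockEquiv, val_blockEquiv]
  simp

theorem blockEquiv_lt {i j : Fin n} (hij : i < j) (a : Fin (k i)) (b : Fin (k j)) :
    blockEquiv h ⟨i, a⟩ < blockEquiv h ⟨j, b⟩ := by
  rw [Fin.lt_def, val_blockEquiv, val_blockEquiv]
  let k' : ℕ → ℕ := fun l => if h : l < n then k ⟨l, h⟩ else 0
  have hk : ∀ i : Fin n, ∑ l : Fin i, k (Fin.castLE i.2.le l) = ∑ l ∈ Finset.range i, k' l := by
    intro i
    rw [← Fin.sum_univ_eq_sum_range]
    refine Finset.sum_congr rfl fun l _ => ?_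
    simp only [k', dif_pos (l.2.trans i.2)]
    rfl
  have hi : k' i = k i := dif_pos i.2
  -- All of block `i` comes before the start of block `j`.
  have hle : ∑ l ∈ Finset.range (i + 1), k' l ≤ ∑ l ∈ Finset.range j, k' l :=
    Finset.sum_le_sum_of_subset (Finset.range_subset_range.2 hij)
  rw [Finset.sum_range_succ, hi] at hle
  rw [hk, hk]
  omega

theorem block_mono {p q : Fin N} (hpq : p ≤ q) :
    ((blockEquiv h).symm p).1 ≤ ((blockEquiv h).symm q).1 := by
  by_contra! hlt
  have := blockEquiv_lt h hlt ((blockEquiv h).symm q).2 ((blockEquiv h).symm p).2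
  simp only [Sigma.eta, Equiv.apply_symm_apply] at this
  exact absurd hpq this.not_ge

/-- Sets with extremes in different blocks are separated on the first curve. Blocks are ordered, so
the extremes of the image are the blocks of `p` and `q`. The map `β` lets callers supply an explicit
table. -/
theorem RepAt.glue_of_lt {C : M (Fin n)} {C' : ∀ i, M (Fin (k i))} {p q : Fin N} {v : Fin n → ℝ}
    {β : Fin N → Fin n} (hβ : ∀ r, ((blockEquiv h).symm r).1 = β r) (hpq : β p < β q)
    (hC : RepAt C (β p) (β q) v) :
    RepAt (glue (blockEquiv h) C C') p q (fun r => v (β r)) := by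
  obtain rfl : β = fun r => ((blockEquiv h).symm r).1 := funext fun r => (hβ r).symm
  intro S hp hq
  have hS : ((fun j => ((blockEquiv h).symm j).1) '' S.1).Nontrivial :=
    ⟨_, ⟨p, hp.1, rfl⟩, _, ⟨q, hq.1, rfl⟩, hpq.ne⟩
  obtain ⟨hv, e⟩ := hC ⟨_, hS⟩
    ⟨⟨p, hp.1, rfl⟩, by rintro _ ⟨r, hr, rfl⟩; exact block_mono h (hp.2 hr)⟩
    ⟨⟨q, hq.1, rfl⟩, by rintro _ ⟨r, hr, rfl⟩; exact block_mono h (hq.2 hr)⟩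
  have hv' : NonconstOn S.1 (fun r => v ((blockEquiv h).symm r).1) := by
    obtain ⟨_, ⟨i, hi, rfl⟩, _, ⟨j, hj, rfl⟩, hij⟩ := hv
    exact ⟨i, hi, j, hj, hij⟩
  refine ⟨hv', ?_⟩
  simp only [glue, glueRaw, dif_pos hS, e]
  rfl

/-- This frees the definition of gluing from its arbitrary choice of an element of `S`. -/
theorem glueRaw_of_subset {ι J : Type} {K : ι → Type} (e : (Σ i, K i) ≃ J) (L : LineProd ι)
    (L' : ∀ i, LineProd (K i)) (S : {S : Set J // S.Nontrivial}) (i : ι)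
    (hS : S.1 ⊆ Set.range (fun a : K i => e ⟨i, a⟩)) :
    glueRaw e L L' S = Line.push (fun a => e ⟨i, a⟩) (blockIncl_injective e i) S.1 hS
      (L' i ⟨_, nontrivial_preimage S.2 hS⟩) := by
  have hblock : ∀ j ∈ S.1, (e.symm j).1 = i := by
    intro j hj
    obtain ⟨a, rfl⟩ := hS hj
    simp
  have hnot : ¬ ((fun j => (e.symm j).1) '' S.1).Nontrivial := by
    rintro ⟨_, ⟨j, hj, rfl⟩, _, ⟨l, hl, rfl⟩, hne⟩
    exact hne ((hblock j hj).trans (hblock l hl).symm)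
  obtain rfl : i = _ := (hblock _ S.2.nonempty.some_mem).symm
  rw [glueRaw, dif_neg hnot]

theorem RepAt.glue_same {C : M (Fin n)} {C' : ∀ i, M (Fin (k i))} {i : Fin n} {a b : Fin (k i)}
    {v : Fin (k i) → ℝ} {w : Fin N → ℝ} (hC : RepAt (C' i) a b v)
    (hw : ∀ c, w (blockEquiv h ⟨i, c⟩) = v c) :
    RepAt (glue (blockEquiv h) C C') (blockEquiv h ⟨i, a⟩) (blockEquiv h ⟨i, b⟩) w := by
  intro S ha hb
  have hS : S.1 ⊆ Set.range (fun a : Fin (k i) => blockEquiv h ⟨i, a⟩) := by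
    intro j hj
    have h1 := block_mono h (ha.2 hj)
    have h2 := block_mono h (hb.2 hj)
    simp only [Equiv.symm_apply_apply] at h1 h2
    obtain rfl := le_antisymm h1 h2
    exact ⟨_, (blockEquiv h).apply_symm_apply j⟩
  obtain ⟨hv, e⟩ := hC ⟨_, nontrivial_preimage S.2 hS⟩
    ⟨ha.1, fun c hc => (blockEquiv_le_iff h).1 (ha.2 hc)⟩
    ⟨hb.1, fun c hc => (blockEquiv_le_iff h).1 (hb.2 hc)⟩
  have hw' : NonconstOn S.1 w := by
    obtain ⟨c, hc, d, hd, hcd⟩ := hv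
    exact ⟨_, hc, _, hd, by rwa [hw, hw]⟩
  refine ⟨hw', ?_⟩
  simp only [glue]
  rw [glueRaw_of_subset _ _ _ _ i hS, e]
  refine Line.mk_eq_mk 1 0 one_ne_zero fun j hj => ?_
  obtain ⟨c, rfl⟩ := hS hj
  dsimp only
  rw [hw, (blockIncl_injective (blockEquiv h) i).extend_apply v 0 c]
  ring

end Block

/-- A family of points of the moduli space, given by vectors `w i j` that describe the coordinates
at all sets with least element `i` and greatest element `j`. -/
theorem exists_family {A : Type*} [TopologicalSpace A] (w : Fin n → Fin n → A → Fin n → ℝ)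
    (hw : ∀ i j, Continuous (w i j)) (hne : ∀ i j, i < j → ∀ a, w i j a i ≠ w i j a j)
    {U : Set A} (hU : Dense U)
    (hconf : ∀ a ∈ U, ∃ x : Fin n → ℝ, StrictAnti x ∧ ∀ i j : Fin n, (i : ℕ) + 1 < j →
      ∃ α β, α ≠ 0 ∧ ∀ k, i ≤ k → k ≤ j → w i j a k = α * x k + β) :
    ∃ f : C(A, M (Fin n)), (∀ a i j, i < j → RepAt (f a) i j (w i j a)) ∧
      (∀ a, f a ∈ positivePart n) := by
  choose lo hi hlt hlo hhi using fun S : {S : Set (Fin n) // S.Nontrivial} => exists_hull S.1 S.2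
  have hnc : ∀ (S : {S : Set (Fin n) // S.Nontrivial}) a, NonconstOn S.1 (w (lo S) (hi S) a) :=
    fun S a => ⟨_, (hlo S).1, _, (hhi S).1, hne _ _ (hlt S) a⟩
  let F : A → LineProd (Fin n) := fun a S => Line.mk S.1 (w (lo S) (hi S) a) (hnc S a)
  have hF : Continuous F := continuous_pi fun S =>
    (Line.continuous_mk S.1).comp (Continuous.subtype_mk (hw (lo S) (hi S)) (hnc S))
  have hFU : ∀ a ∈ U, ∃ (x : Fin n → ℝ) (hx : StrictAnti x), F a = conf x hx.injective := by
    intro a ha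
    obtain ⟨x, hx, h⟩ := hconf a ha
    refine ⟨x, hx, funext fun S => ?_⟩
    obtain ⟨α, β, hα, h⟩ : ∃ α β, α ≠ 0 ∧
        ∀ k, lo S ≤ k → k ≤ hi S → w (lo S) (hi S) a k = α * x k + β := by
      -- Between neighbours there is nothing to check: any two pairs of distinct reals differ by an
      -- affine map.
      by_cases hadj : (lo S : ℕ) + 1 < hi S
      · exact h _ _ hadj
      · obtain ⟨α, β, hα, h1, h2⟩ := exists_affine (hx (hlt S)).ne' (hne _ _ (hlt S) a)
        refine ⟨α, β, hα, fun k hk hk' => ?_⟩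
        have := hlt S
        obtain rfl | rfl : k = lo S ∨ k = hi S := by omega
        · exact h1
        · exact h2
    exact (Line.mk_eq_mk α β hα fun k hk => h k ((hlo S).2 hk) ((hhi S).2 hk)).symm
  have hmem : ∀ a, F a ∈ closure (confSet (Fin n)) := fun a =>
    map_mem_closure hF (hU a) fun a ha => by
      obtain ⟨x, hx, h⟩ := hFU a ha
      exact ⟨x, hx.injective, h⟩
  have hf : Continuous fun a => (⟨F a, hmem a⟩ : M (Fin n)) := hF.subtype_mk _
  refine ⟨⟨_, hf⟩, ?_, fun a => map_mem_closure hf (hU a) fun a ha => hFU a ha⟩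
  intro a i j _ S hi' hj'
  have h1 : lo S = i := (hlo S).unique hi'
  have h2 : hi S = j := (hhi S).unique hj'
  subst h1 h2
  exact ⟨hnc S a, rfl⟩

end Hull

theorem dense_Ioo_unitInterval : Dense (Set.Ioo (0 : I) 1) := by
  intro t
  rw [closure_Ioo zero_ne_one]
  exact ⟨t.2.1, t.2.2⟩

/-! ### The non-negative part for three labels -/

section Segment

/-- The vectors which describe the point with coordinate `t` on the segment from `(12)3` to
`1(23)`. -/
noncomputable def segmentVec (i j : Fin 3) (t : I) : Fin 3 → ℝ :=
  if i = 0 ∧ j = 2 then ![1, 1 - t, 0] else ![2, 1, 0]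

theorem strictAnti_segmentVec {t : I} (ht : t ∈ Set.Ioo (0 : I) 1) :
    StrictAnti ![1, 1 - (t : ℝ), 0] := by
  rw [Fin.strictAnti_iff_succ_lt]
  intro i
  fin_cases i
  · simpa using ht.1
  · simpa using ht.2

theorem exists_segment : ∃ f : C(I, M (Fin 3)),
    (∀ t i j, i < j → RepAt (f t) i j (segmentVec i j t)) ∧ ∀ t, f t ∈ positivePart 3 := by
  refine exists_family segmentVec ?_ ?_ dense_Ioo_unitInterval ?_
  · intro i j
    unfold segmentVec
    split_ifs
    · refine continuous_pi fun k => ?_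
      fin_cases k <;> simp <;> fun_prop
    · fun_prop
  · intro i j hij t
    unfold segmentVec
    fin_cases i <;> fin_cases j <;> simp at hij ⊢
  · intro t ht
    refine ⟨_, strictAnti_segmentVec ht, fun i j hij => ⟨1, 0, one_ne_zero, fun k _ _ => ?_⟩⟩
    rw [segmentVec, if_pos (by omega)]
    ring

/-- The segment from `(12)3` to `1(23)`, parametrized by `(x₀ - x₁) / (x₀ - x₂)`. -/
noncomputable def segment : C(I, M (Fin 3)) := exists_segment.choose

theorem repAt_segment (t : I) : RepAt (segment t) 0 2 ![1, 1 - t, 0] :=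
  exists_segment.choose_spec.1 t 0 2 (by decide)

theorem segment_mem (t : I) : segment t ∈ positivePart 3 := exists_segment.choose_spec.2 t

/-- The pair `0, 2` is the only one that is not a pair of neighbours. -/
theorem ext_of_repAt_three {L L' : M (Fin 3)} {v : Fin 3 → ℝ} (h : RepAt L 0 2 v)
    (h' : RepAt L' 0 2 v) : L = L' := by
  refine ext_of_repAt fun i j hij => ?_
  by_cases hadj : i = 0 ∧ j = 2
  · obtain ⟨rfl, rfl⟩ := hadj
    exact ⟨v, h, h'⟩
  · have hb : ∀ k, i ≤ k → k ≤ j → k = i ∨ k = j := by omega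
    have hv : (fun k : Fin 3 => (k : ℝ)) i ≠ (fun k : Fin 3 => (k : ℝ)) j := by
      simpa [Fin.ext_iff] using hij.ne
    exact ⟨fun k => (k : ℝ), RepAt.of_adjacent L hb hv, RepAt.of_adjacent L' hb hv⟩

theorem ext_of_repAt_four {L L' : M (Fin 4)} {u v w : Fin 4 → ℝ}
    (h02 : RepAt L 0 2 u) (h02' : RepAt L' 0 2 u) (h13 : RepAt L 1 3 v) (h13' : RepAt L' 1 3 v)
    (h03 : RepAt L 0 3 w) (h03' : RepAt L' 0 3 w) : L = L' := by
  refine ext_of_repAt fun i j hij => ?_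
  by_cases h1 : i = 0 ∧ j = 2
  · obtain ⟨rfl, rfl⟩ := h1
    exact ⟨u, h02, h02'⟩
  by_cases h2 : i = 1 ∧ j = 3
  · obtain ⟨rfl, rfl⟩ := h2
    exact ⟨v, h13, h13'⟩
  by_cases h3 : i = 0 ∧ j = 3
  · obtain ⟨rfl, rfl⟩ := h3
    exact ⟨w, h03, h03'⟩
  have hb : ∀ k, i ≤ k → k ≤ j → k = i ∨ k = j := by omega
  have hv : (fun k : Fin 4 => (k : ℝ)) i ≠ (fun k : Fin 4 => (k : ℝ)) j := by
    simpa [Fin.ext_iff] using hij.ne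
  exact ⟨fun k => (k : ℝ), RepAt.of_adjacent L hb hv, RepAt.of_adjacent L' hb hv⟩

theorem repAt_two (C : M (Fin 2)) : RepAt C 0 1 ![1, 0] :=
  RepAt.of_adjacent C (by omega) (by simp)

/-- At `t = 0` the first two labels collide. The curves are arbitrary because the moduli spaces for
one and two labels are points, so the lemma applies directly to underlying curves of compositions.
-/
theorem segment_zero_eq_glue (C : M (Fin 2)) (C' : ∀ i : Fin 2, M (Fin (![2, 1] i))) :
    segment 0 = glue (blockEquiv (k := ![2, 1]) (N := 3) rfl) C C' := by
  refine ext_of_repAt_three (repAt_segment 0) ?_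
  refine (RepAt.glue_of_lt (k := ![2, 1]) (N := 3) rfl (β := ![0, 0, 1])
    (fun r => by fin_cases r <;> rfl) (by decide) (repAt_two _)).affine 1 0 one_ne_zero ?_
  intro k _ _
  fin_cases k <;> simp

theorem segment_one_eq_glue (C : M (Fin 2)) (C' : ∀ i : Fin 2, M (Fin (![1, 2] i))) :
    segment 1 = glue (blockEquiv (k := ![1, 2]) (N := 3) rfl) C C' := by
  refine ext_of_repAt_three (repAt_segment 1) ?_
  refine (RepAt.glue_of_lt (k := ![1, 2]) (N := 3) rfl (β := ![0, 1, 1])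
    (fun r => by fin_cases r <;> rfl) (by decide) (repAt_two _)).affine 1 0 one_ne_zero ?_
  intro k _ _
  fin_cases k <;> simp

theorem segment_zero : segment 0 = pt12_3 := segment_zero_eq_glue _ _

theorem segment_one : segment 1 = pt1_23 := segment_one_eq_glue _ _

theorem pt12_3_mem : pt12_3 ∈ positivePart 3 := segment_zero ▸ segment_mem 0

theorem pt1_23_mem : pt1_23 ∈ positivePart 3 := segment_one ▸ segment_mem 1

/-- The coordinate `|x₀ - x₁| / (|x₀ - x₁| + |x₁ - x₂|)` on the projective line. -/
noncomputable def lineCoord : Line (Set.univ : Set (Fin 3)) → I :=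
  Quotient.lift
    (fun x => ⟨|x.1 0 - x.1 1| / (|x.1 0 - x.1 1| + |x.1 1 - x.1 2|), by positivity,
      div_le_one_of_le₀ (le_add_of_nonneg_right (abs_nonneg _)) (by positivity)⟩)
    (by
      rintro x y ⟨a, b, ha, h⟩
      refine Subtype.ext ?_
      have h' : ∀ i j, |y.1 i - y.1 j| = |a| * |x.1 i - x.1 j| := by
        intro i j
        rw [h i trivial, h j trivial, ← abs_mul]
        congr 1
        ring
      dsimp only
      rw [h', h', ← mul_add, mul_div_mul_left _ _ (abs_ne_zero.2 ha)])

theorem continuous_lineCoord : Continuous lineCoord := by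
  refine Continuous.quotient_lift (Continuous.subtype_mk ?_ _) _
  have h : ∀ i, Continuous fun x : {x : Fin 3 → ℝ // NonconstOn Set.univ x} => x.1 i := fun i =>
    (continuous_apply i).comp continuous_subtype_val
  refine Continuous.div ((h 0).sub (h 1)).abs
    (((h 0).sub (h 1)).abs.add ((h 1).sub (h 2)).abs) fun x hx => ?_
  obtain ⟨i, -, j, -, hij⟩ := x.2
  have h1 : |x.1 0 - x.1 1| = 0 := by
    linarith [abs_nonneg (x.1 0 - x.1 1), abs_nonneg (x.1 1 - x.1 2)]
  have h2 : |x.1 1 - x.1 2| = 0 := by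
    linarith [abs_nonneg (x.1 0 - x.1 1), abs_nonneg (x.1 1 - x.1 2)]
  rw [abs_eq_zero, sub_eq_zero] at h1 h2
  refine hij ?_
  fin_cases i <;> fin_cases j <;> simp [h1, h2]

theorem nontrivial_univ_three : (Set.univ : Set (Fin 3)).Nontrivial :=
  ⟨0, trivial, 1, trivial, by decide⟩

/-- The retraction of the moduli space onto the segment, in coordinates. -/
noncomputable def coord (L : M (Fin 3)) : I := lineCoord (L.1 ⟨_, nontrivial_univ_three⟩)

theorem continuous_coord : Continuous coord :=
  continuous_lineCoord.comp ((continuous_apply _).comp continuous_subtype_val)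

theorem coord_of_repAt {L : M (Fin 3)} {v : Fin 3 → ℝ} (h : RepAt L 0 2 v) :
    (coord L : ℝ) = |v 0 - v 1| / (|v 0 - v 1| + |v 1 - v 2|) := by
  obtain ⟨hv, e⟩ := h ⟨Set.univ, nontrivial_univ_three⟩ ⟨trivial, fun _ _ => Fin.zero_le _⟩
    ⟨trivial, fun i _ => by omega⟩
  rw [coord, e]
  rfl

theorem coord_segment (t : I) : coord (segment t) = t := by
  refine Subtype.ext ?_
  rw [coord_of_repAt (repAt_segment t)]
  have h0 := t.2.1
  have h1 := t.2.2
  simp [abs_of_nonneg h0, abs_of_nonneg (sub_nonneg.2 h1)]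

/-- The equation is a closed condition because the moduli space is Hausdorff, so it suffices to
check it for decreasing configurations, where both sides are the same up to rescaling. -/
theorem segment_coord {L : M (Fin 3)} (hL : L ∈ positivePart 3) : segment (coord L) = L := by
  have hclosed : IsClosed {L : M (Fin 3) | segment (coord L) = L} :=
    isClosed_eq (segment.continuous.comp continuous_coord) continuous_id
  refine closure_minimal ?_ hclosed hL
  rintro ⟨L, hL⟩ ⟨x, hx, rfl⟩
  have h01 : 0 < x 0 - x 1 := sub_pos.2 (hx (by decide))
  have h12 : 0 < x 1 - x 2 := sub_pos.2 (hx (by decide))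
  have hrep := repAt_conf hx.injective hL 0 2
  refine ext_of_repAt_three (repAt_segment _) (hrep.affine (1 / (x 0 - x 2))
    (- (1 / (x 0 - x 2)) * x 2) (by apply one_div_ne_zero; linarith) ?_)
  have h02 : x 0 - x 2 ≠ 0 := by linarith
  intro k _ _
  rw [coord_of_repAt hrep, abs_of_pos h01, abs_of_pos h12, sub_add_sub_cancel]
  fin_cases k <;> simp <;> field_simp <;> ring

/-- The non-negative part of the moduli space of curves with 4 marked points is an interval. -/
noncomputable def segmentHomeomorph : I ≃ₜ positivePart 3 where
  toFun t := ⟨segment t, segment_mem t⟩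
  invFun L := coord L.1
  left_inv := coord_segment
  right_inv L := Subtype.ext (segment_coord L.2)
  continuous_toFun := segment.continuous.subtype_mk _
  continuous_invFun := continuous_coord.comp continuous_subtype_val

theorem contractibleSpace_unitInterval : ContractibleSpace I :=
  (convex_Icc (0 : ℝ) 1).contractibleSpace ⟨0, by simp⟩

theorem contractibleSpace_positivePart : ContractibleSpace (positivePart 3) :=
  have := contractibleSpace_unitInterval
  segmentHomeomorph.symm.contractibleSpace

theorem continuous_relabel {ι κ : Type} (e : ι ≃ κ) : Continuous (relabel e) := by
  refine Continuous.subtype_mk (continuous_pi fun S => ?_) _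
  exact (Line.continuous_pull _ _).comp ((continuous_apply _).comp continuous_subtype_val)

/-- Reversing the order of the marked points reverses the segment. -/
theorem relabel_rev_segment (t : I) : relabel Fin.revPerm (segment (σ t)) = segment t := by
  have hclosed : IsClosed {t : I | relabel Fin.revPerm (segment (σ t)) = segment t} := by
    refine isClosed_eq ((continuous_relabel _).comp (segment.continuous.comp ?_)) segment.continuous
    exact unitInterval.continuous_symm
  refine closure_minimal ?_ hclosed (dense_Ioo_unitInterval t)
  intro t ht
  have h0 : (0 : ℝ) < t := ht.1
  have h1 : (t : ℝ) < 1 := ht.2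
  have hseg : ∀ s : I, ∀ hs : s ∈ Set.Ioo (0 : I) 1,
      segment s = ⟨conf _ (strictAnti_segmentVec hs).injective, subset_closure ⟨_, _, rfl⟩⟩ := fun s hs =>
    ext_of_repAt_three (repAt_segment s) (repAt_conf _ _ 0 2)
  have ht' : σ t ∈ Set.Ioo (0 : I) 1 := by
    constructor
    · change (0 : ℝ) < (σ t : ℝ)
      simpa using h1
    · change (σ t : ℝ) < 1
      simpa using h0
  change relabel Fin.revPerm (segment (σ t)) = segment t
  rw [hseg _ ht', hseg _ ht]
  refine Subtype.ext (funext fun S => ?_)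
  -- Reversal turns `(1, t, 0)` into `(0, t, 1)`, which `x ↦ 1 - x` carries to `(1, 1 - t, 0)`.
  refine Line.mk_eq_mk (-1) 1 (by norm_num) fun i _ => ?_
  dsimp only
  fin_cases i <;> simp [Fin.revPerm, Fin.rev, sub_eq_neg_add]

end Segment

/-! ### The pentagon of configurations of four points -/

section Pentagon

/-- The positions of four points with gaps `a`, `b`, `c`. -/
def ofGaps (a b c : ℝ) : Fin 4 → ℝ := ![a + b + c, b + c, c, 0]

/-- The vectors which describe a family of points of the non-negative part of the moduli space of
curves with five marked points, parametrized by `r`, `p`, `q`: it is the square with coordinates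
`1 - r * p` and `1 - r * q`, blown up at one corner. -/
def pentagonVec (r p q : ℝ) (i j : Fin 4) : Fin 4 → ℝ :=
  if i = 0 ∧ j = 2 then ofGaps (1 - r * p) (r * p) 0
  else if i = 1 ∧ j = 3 then ofGaps 0 (r * q) (1 - r * q)
  else if i = 0 ∧ j = 3 then ofGaps (q * (1 - r * p)) (r * p * q) (p * (1 - r * q))
  else ofGaps 1 1 1

/-- Only the pair `0, 3` needs care. Its total gap is `p + q - r * p * q ≥ q + p * (1 - q)`, which
is positive as `p` and `q` do not both vanish. This is the purpose of blowing up: the factor `r` has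
been divided out of the gaps. -/
theorem pentagonVec_ne {r p q : ℝ} (hr : r ∈ Set.Icc (0 : ℝ) 1) (hp : p ∈ Set.Icc (0 : ℝ) 1)
    (hq : q ∈ Set.Icc (0 : ℝ) 1) (hpq : 0 < p + q) {i j : Fin 4} (hij : i < j) :
    pentagonVec r p q i j i ≠ pentagonVec r p q i j j := by
  have h03 : q * (1 - r * p) + r * p * q + p * (1 - r * q) ≠ 0 := by
    have h1 : r * p * q ≤ 1 * p * q := by
      have := hr.2; have := hp.1; have := hq.1
      gcongr
    have h2 : 0 ≤ p * (1 - q) := mul_nonneg hp.1 (sub_nonneg.2 hq.2)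
    rcases hq.1.eq_or_lt with rfl | hq0
    · simp at hpq ⊢
      exact hpq.ne'
    · nlinarith
  unfold pentagonVec ofGaps
  fin_cases i <;> fin_cases j <;> (simp at hij ⊢; try assumption)

/-- The first coordinate on the boundary curve of the blown up corner. -/
noncomputable def cornerLeft (t : ℝ) : ℝ := min 1 (2 * (1 - t))

/-- The second coordinate on the boundary curve of the blown up corner. -/
noncomputable def cornerRight (t : ℝ) : ℝ := min 1 (2 * t)

theorem cornerLeft_mem (t : I) : cornerLeft t ∈ Set.Icc (0 : ℝ) 1 :=
  ⟨le_min zero_le_one (by linarith [t.2.2]), min_le_left _ _⟩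

theorem cornerRight_mem (t : I) : cornerRight t ∈ Set.Icc (0 : ℝ) 1 :=
  ⟨le_min zero_le_one (by linarith [t.2.1]), min_le_left _ _⟩

/-- At each `t` one of the two coordinates is `1`: the curve goes from `(1, 0)` through `(1, 1)` to
`(0, 1)`. -/
theorem corner_add_pos (t : I) : 0 < cornerLeft t + cornerRight t := by
  unfold cornerLeft cornerRight
  rcases le_total (t : ℝ) (1 / 2) with h | h
  · rw [min_eq_left (by linarith)]
    linarith [(cornerRight_mem t).1, show min 1 (2 * (t : ℝ)) = cornerRight t from rfl]
  · rw [min_eq_left (b := 2 * (t : ℝ)) (by linarith)]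
    linarith [(cornerLeft_mem t).1, show min 1 (2 * (1 - (t : ℝ))) = cornerLeft t from rfl]

theorem continuous_cornerLeft : Continuous cornerLeft := by
  unfold cornerLeft
  fun_prop

theorem continuous_cornerRight : Continuous cornerRight := by
  unfold cornerRight
  fun_prop

theorem continuous_ofGaps {A : Type*} [TopologicalSpace A] {a b c : A → ℝ} (ha : Continuous a)
    (hb : Continuous b) (hc : Continuous c) : Continuous fun t => ofGaps (a t) (b t) (c t) := by
  refine continuous_pi fun k => ?_
  unfold ofGaps
  fin_cases k <;> simp <;> fun_prop

theorem exists_pentagon : ∃ f : C(I × I, M (Fin 4)),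
    (∀ a i j, i < j → RepAt (f a) i j (pentagonVec a.1 (cornerLeft a.2) (cornerRight a.2) i j)) ∧
      ∀ a, f a ∈ positivePart 4 := by
  have hl : Continuous fun a : I × I => cornerLeft a.2 :=
    continuous_cornerLeft.comp (by fun_prop)
  have hr : Continuous fun a : I × I => cornerRight a.2 :=
    continuous_cornerRight.comp (by fun_prop)
  have hc : Continuous fun a : I × I => (a.1 : ℝ) := by fun_prop
  refine exists_family
    (fun i j (a : I × I) => pentagonVec a.1 (cornerLeft a.2) (cornerRight a.2) i j) ?_
    (fun i j hij a => pentagonVec_ne a.1.2 (cornerLeft_mem _) (cornerRight_mem _)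
      (corner_add_pos _) hij) (dense_Ioo_unitInterval.prod dense_Ioo_unitInterval) ?_
  · intro i j
    unfold pentagonVec
    split_ifs <;> apply continuous_ofGaps <;> fun_prop
  · rintro ⟨a, t⟩ ⟨⟨ha0, ha1⟩, ht0, ht1⟩
    have ha0 : (0 : ℝ) < a := ha0
    have ha1 : (a : ℝ) < 1 := ha1
    have ht0 : (0 : ℝ) < t := ht0
    have ht1 : (t : ℝ) < 1 := ht1
    have hp0 : 0 < cornerLeft t := lt_min one_pos (by linarith)
    have hq0 : 0 < cornerRight t := lt_min one_pos (by linarith)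
    have hp1 := (cornerLeft_mem t).2
    have hq1 := (cornerRight_mem t).2
    dsimp only
    generalize cornerLeft t = p at *
    generalize cornerRight t = q at *
    have hap : 0 < 1 - a * p := by nlinarith
    have haq : 0 < 1 - a * q := by nlinarith
    -- With these gaps the first two add up to `q` and the last two to `p`, so the middle gap takes
    -- the fractions `a * p` and `a * q` of them.
    refine ⟨ofGaps (q * (1 - a * p)) (a * p * q) (p * (1 - a * q)), ?_, ?_⟩
    · rw [Fin.strictAnti_iff_succ_lt]
      intro i
      have h1 : 0 < q * (1 - a * p) := by positivity
      have h2 : 0 < a * p * q := by positivity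
      have h3 : 0 < p * (1 - a * q) := by positivity
      unfold ofGaps
      fin_cases i <;> simp <;> assumption
    · intro i j hij
      obtain ⟨rfl, rfl⟩ | ⟨rfl, rfl⟩ | ⟨rfl, rfl⟩ :
          i = 0 ∧ j = 2 ∨ i = 1 ∧ j = 3 ∨ i = 0 ∧ j = 3 := by omega
      -- Normalize `x₀ - x₂ = q` to `1` and move `x₂` to `0`.
      · refine ⟨1 / q, - (p * (1 - a * q)) / q, by positivity, fun k _ hk => ?_⟩
        unfold pentagonVec ofGaps
        fin_cases k
        · simp; field_simp; ring
        · simp; field_simp; ring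
        · simp; field_simp; ring
        · simp at hk
      -- Normalize `x₁ - x₃ = p` to `1`; `x₃` is already `0`.
      · refine ⟨1 / p, 0, by positivity, fun k hk _ => ?_⟩
        unfold pentagonVec ofGaps
        fin_cases k
        · simp at hk
        · simp; field_simp; ring
        · simp; field_simp
        · simp
      · refine ⟨1, 0, one_ne_zero, fun k _ _ => ?_⟩
        simp [pentagonVec]

/-- A map from the square to the non-negative part of the moduli space of curves with five marked
points, whose sides go to the five sides of the pentagon. -/
noncomputable def pentagon : C(I × I, M (Fin 4)) := exists_pentagon.choose

theorem repAt_pentagon (a : I × I) {i j : Fin 4} (hij : i < j) :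
    RepAt (pentagon a) i j (pentagonVec a.1 (cornerLeft a.2) (cornerRight a.2) i j) :=
  exists_pentagon.choose_spec.1 a i j hij

theorem repAt_pentagon_zero_two (a : I × I) :
    RepAt (pentagon a) 0 2 (ofGaps (1 - a.1 * cornerLeft a.2) (a.1 * cornerLeft a.2) 0) :=
  repAt_pentagon a (by decide)

theorem repAt_pentagon_one_three (a : I × I) :
    RepAt (pentagon a) 1 3 (ofGaps 0 (a.1 * cornerRight a.2) (1 - a.1 * cornerRight a.2)) :=
  repAt_pentagon a (by decide)

theorem repAt_pentagon_zero_three (a : I × I) :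
    RepAt (pentagon a) 0 3 (ofGaps (cornerRight a.2 * (1 - a.1 * cornerLeft a.2))
      (a.1 * cornerLeft a.2 * cornerRight a.2)
      (cornerLeft a.2 * (1 - a.1 * cornerRight a.2))) :=
  repAt_pentagon a (by decide)

theorem cornerLeft_zero : cornerLeft 0 = 1 := by norm_num [cornerLeft]
theorem cornerLeft_one : cornerLeft 1 = 0 := by norm_num [cornerLeft]
theorem cornerRight_zero : cornerRight 0 = 0 := by norm_num [cornerRight]
theorem cornerRight_one : cornerRight 1 = 1 := by norm_num [cornerRight]

/-- The last entry lies outside the range from `0` to `1` and plays no role. -/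
theorem repAt_three_zero_one (C : M (Fin 3)) : RepAt C 0 1 ![1, 0, 0] :=
  RepAt.of_adjacent C (by omega) (by simp)

theorem repAt_three_one_two (C : M (Fin 3)) : RepAt C 1 2 ![1, 1, 0] :=
  RepAt.of_adjacent C (by omega) (by simp)

/-- The coordinate on the boundary curve of the blown up corner. -/
noncomputable def cornerRatio : C(I, I) where
  toFun t := ⟨cornerRight t / (cornerLeft t + cornerRight t),
    div_nonneg (cornerRight_mem t).1 (corner_add_pos t).le,
    div_le_one_of_le₀ (le_add_of_nonneg_left (cornerLeft_mem t).1) (corner_add_pos t).le⟩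
  continuous_toFun := by
    refine Continuous.subtype_mk (Continuous.div ?_ ?_ fun t => (corner_add_pos t).ne') _
    · exact continuous_cornerRight.comp continuous_subtype_val
    · exact (continuous_cornerLeft.comp continuous_subtype_val).add
        (continuous_cornerRight.comp continuous_subtype_val)

/-- The first half of the interval. -/
noncomputable def halfLeft : C(I, I) where
  toFun t := ⟨t / 2, by linarith [t.2.1], by linarith [t.2.2]⟩
  continuous_toFun := by fun_prop

/-- The second half of the interval. -/
noncomputable def halfRight : C(I, I) where
  toFun t := ⟨(1 + t) / 2, by linarith [t.2.1], by linarith [t.2.2]⟩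
  continuous_toFun := by fun_prop

theorem cornerRatio_zero : cornerRatio 0 = 0 :=
  Subtype.ext (by simp [cornerRatio, cornerRight_zero])

theorem cornerRatio_one : cornerRatio 1 = 1 :=
  Subtype.ext (by simp [cornerRatio, cornerLeft_one, cornerRight_one])

theorem halfLeft_zero : halfLeft 0 = 0 := Subtype.ext (by simp [halfLeft])

theorem halfRight_zero : halfRight 0 = halfLeft 1 := Subtype.ext (by simp [halfLeft, halfRight])

theorem halfRight_one : halfRight 1 = 1 := Subtype.ext (by norm_num [halfRight])

theorem cornerLeft_halfLeft (t : I) : cornerLeft (halfLeft t) = 1 :=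
  min_eq_left (by change 1 ≤ 2 * (1 - (t : ℝ) / 2); linarith [t.2.2])

theorem cornerRight_halfLeft (t : I) : cornerRight (halfLeft t) = t := by
  have : 2 * ((t : ℝ) / 2) = t := by ring
  change min 1 (2 * ((t : ℝ) / 2)) = t
  rw [this, min_eq_right t.2.2]

theorem cornerLeft_halfRight (t : I) : cornerLeft (halfRight t) = 1 - t := by
  have : 2 * (1 - (1 + (t : ℝ)) / 2) = 1 - t := by ring
  change min 1 (2 * (1 - (1 + (t : ℝ)) / 2)) = 1 - t
  rw [this, min_eq_right (by linarith [t.2.1])]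

theorem cornerRight_halfRight (t : I) : cornerRight (halfRight t) = 1 :=
  min_eq_left (by change 1 ≤ 2 * ((1 + (t : ℝ)) / 2); linarith [t.2.1])

/-- Here `(p, q) = (1, 0)`, so seen from the pair `0, 3` the first three labels collide, and among
them the ratio is `1 - r`. Hence the reversal `σ`. -/
theorem pentagon_left (t : I) (C : M (Fin 2)) (C' : ∀ i : Fin 2, M (Fin (![3, 1] i)))
    (hC' : C' 0 = segment t) :
    pentagon (σ t, 0) = glue (blockEquiv (k := ![3, 1]) (N := 4) rfl) C C' := by
  have hβ : ∀ r, ((blockEquiv (k := ![3, 1]) (N := 4) rfl).symm r).1 = ![0, 0, 0, 1] r :=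
    fun r => by fin_cases r <;> rfl
  refine ext_of_repAt_four (repAt_pentagon_zero_two _) ?_ (repAt_pentagon_one_three _) ?_
    (repAt_pentagon_zero_three _) ?_
  · refine RepAt.glue_same (k := ![3, 1]) (N := 4) rfl (i := 0) (a := (0 : Fin 3))
      (b := (2 : Fin 3)) (hC' ▸ repAt_segment t) ?_
    change ∀ c : Fin 3, _
    intro c
    fin_cases c
    · change ofGaps _ _ _ (0 : Fin 4) = _
      simp [ofGaps, cornerLeft_zero]
    · change ofGaps _ _ _ (1 : Fin 4) = _
      simp [ofGaps, cornerLeft_zero]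
    · change ofGaps _ _ _ (2 : Fin 4) = _
      simp [ofGaps, cornerLeft_zero]
  · refine (RepAt.glue_of_lt (k := ![3, 1]) (N := 4) rfl hβ (by decide) (repAt_two _)).affine
      1 0 one_ne_zero ?_
    intro k hk hk'
    fin_cases k <;> simp [ofGaps, cornerRight_zero] at hk hk' ⊢
  · refine (RepAt.glue_of_lt (k := ![3, 1]) (N := 4) rfl hβ (by decide) (repAt_two _)).affine
      1 0 one_ne_zero ?_
    intro k hk hk'
    fin_cases k <;> simp [ofGaps, cornerLeft_zero, cornerRight_zero] at hk hk' ⊢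

/-- Here `(p, q) = (0, 1)`, so the last three labels collide, with ratio `r` among them. -/
theorem pentagon_right (t : I) (C : M (Fin 2)) (C' : ∀ i : Fin 2, M (Fin (![1, 3] i)))
    (hC' : C' 1 = segment t) :
    pentagon (t, 1) = glue (blockEquiv (k := ![1, 3]) (N := 4) rfl) C C' := by
  have hβ : ∀ r, ((blockEquiv (k := ![1, 3]) (N := 4) rfl).symm r).1 = ![0, 1, 1, 1] r :=
    fun r => by fin_cases r <;> rfl
  refine ext_of_repAt_four (repAt_pentagon_zero_two _) ?_ (repAt_pentagon_one_three _) ?_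
    (repAt_pentagon_zero_three _) ?_
  · refine (RepAt.glue_of_lt (k := ![1, 3]) (N := 4) rfl hβ (by decide) (repAt_two _)).affine
      1 0 one_ne_zero ?_
    intro k hk hk'
    fin_cases k <;> simp [ofGaps, cornerLeft_one] at hk hk' ⊢
  · refine RepAt.glue_same (k := ![1, 3]) (N := 4) rfl (i := 1) (a := (0 : Fin 3))
      (b := (2 : Fin 3)) (hC' ▸ repAt_segment t) ?_
    change ∀ c : Fin 3, _
    intro c
    fin_cases c
    · change ofGaps _ _ _ (1 : Fin 4) = _
      simp [ofGaps, cornerRight_one]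
    · change ofGaps _ _ _ (2 : Fin 4) = _
      simp [ofGaps, cornerRight_one]
    · change ofGaps _ _ _ (3 : Fin 4) = _
      simp [ofGaps, cornerRight_one]
  · refine (RepAt.glue_of_lt (k := ![1, 3]) (N := 4) rfl hβ (by decide) (repAt_two _)).affine
      1 0 one_ne_zero ?_
    intro k hk hk'
    fin_cases k <;> simp [ofGaps, cornerLeft_one, cornerRight_one] at hk hk' ⊢

/-- At `r = 0`, the blown up corner, the middle gap vanishes and the outer ones are `q` and `p`.
This gives the ratio `q / (p + q)` and explains the rescaling by `p + q` in the proof. -/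
theorem pentagon_bottom (t : I) (C : M (Fin 3)) (C' : ∀ i : Fin 3, M (Fin (![1, 2, 1] i)))
    (hC : C = segment (cornerRatio t)) :
    pentagon (0, t) = glue (blockEquiv (k := ![1, 2, 1]) (N := 4) rfl) C C' := by
  have hβ : ∀ r, ((blockEquiv (k := ![1, 2, 1]) (N := 4) rfl).symm r).1 = ![0, 1, 1, 2] r :=
    fun r => by fin_cases r <;> rfl
  refine ext_of_repAt_four (repAt_pentagon_zero_two _) ?_ (repAt_pentagon_one_three _) ?_
    (repAt_pentagon_zero_three _) ?_
  · refine (RepAt.glue_of_lt (k := ![1, 2, 1]) (N := 4) rfl hβ (by decide) (repAt_three_zero_one _)).affine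
      1 0 one_ne_zero ?_
    intro k hk hk'
    fin_cases k <;> simp [ofGaps] at hk hk' ⊢
  · refine (RepAt.glue_of_lt (k := ![1, 2, 1]) (N := 4) rfl hβ (by decide) (repAt_three_one_two _)).affine
      1 0 one_ne_zero ?_
    intro k hk hk'
    fin_cases k <;> simp [ofGaps] at hk hk' ⊢
  · refine (RepAt.glue_of_lt (k := ![1, 2, 1]) (N := 4) rfl hβ (by decide)
      (hC ▸ repAt_segment _)).affine (cornerLeft t + cornerRight t) 0 (corner_add_pos t).ne' ?_
    have hne := (corner_add_pos t).ne'
    intro k _ _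
    fin_cases k <;> simp [ofGaps, cornerRatio]
    · ring
    · field_simp
      ring
    · field_simp
      ring

/-- The side `r = 1` covers two sides of the pentagon. On its first half `p = 1`, so the first gap
vanishes; on the second half `q = 1`, so the last gap does. -/
theorem pentagon_top_left (t : I) (C : M (Fin 3)) (C' : ∀ i : Fin 3, M (Fin (![2, 1, 1] i)))
    (hC : C = segment t) :
    pentagon (1, halfLeft t) = glue (blockEquiv (k := ![2, 1, 1]) (N := 4) rfl) C C' := by
  have hβ : ∀ r, ((blockEquiv (k := ![2, 1, 1]) (N := 4) rfl).symm r).1 = ![0, 0, 1, 2] r :=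
    fun r => by fin_cases r <;> rfl
  refine ext_of_repAt_four (repAt_pentagon_zero_two _) ?_ (repAt_pentagon_one_three _) ?_
    (repAt_pentagon_zero_three _) ?_
  · refine (RepAt.glue_of_lt (k := ![2, 1, 1]) (N := 4) rfl hβ (by decide) (repAt_three_zero_one _)).affine
      1 0 one_ne_zero ?_
    intro k hk hk'
    fin_cases k <;> simp [ofGaps, cornerLeft_halfLeft] at hk hk' ⊢
  · refine (RepAt.glue_of_lt (k := ![2, 1, 1]) (N := 4) rfl hβ (by decide) (hC ▸ repAt_segment _)).affine
      1 0 one_ne_zero ?_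
    intro k hk hk'
    fin_cases k <;> simp [ofGaps, cornerRight_halfLeft] at hk hk' ⊢
  · refine (RepAt.glue_of_lt (k := ![2, 1, 1]) (N := 4) rfl hβ (by decide) (hC ▸ repAt_segment _)).affine
      1 0 one_ne_zero ?_
    intro k hk hk'
    fin_cases k <;> simp [ofGaps, cornerLeft_halfLeft, cornerRight_halfLeft] at hk hk' ⊢

theorem pentagon_top_right (t : I) (C : M (Fin 3)) (C' : ∀ i : Fin 3, M (Fin (![1, 1, 2] i)))
    (hC : C = segment t) :
    pentagon (1, halfRight t) = glue (blockEquiv (k := ![1, 1, 2]) (N := 4) rfl) C C' := by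
  have hβ : ∀ r, ((blockEquiv (k := ![1, 1, 2]) (N := 4) rfl).symm r).1 = ![0, 1, 2, 2] r :=
    fun r => by fin_cases r <;> rfl
  refine ext_of_repAt_four (repAt_pentagon_zero_two _) ?_ (repAt_pentagon_one_three _) ?_
    (repAt_pentagon_zero_three _) ?_
  · refine (RepAt.glue_of_lt (k := ![1, 1, 2]) (N := 4) rfl hβ (by decide) (hC ▸ repAt_segment _)).affine
      1 0 one_ne_zero ?_
    intro k hk hk'
    fin_cases k <;> simp [ofGaps, cornerLeft_halfRight] at hk hk' ⊢
  · refine (RepAt.glue_of_lt (k := ![1, 1, 2]) (N := 4) rfl hβ (by decide) (repAt_three_one_two _)).affine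
      1 0 one_ne_zero ?_
    intro k hk hk'
    fin_cases k <;> simp [ofGaps, cornerRight_halfRight] at hk hk' ⊢
  · refine (RepAt.glue_of_lt (k := ![1, 1, 2]) (N := 4) rfl hβ (by decide) (hC ▸ repAt_segment _)).affine
      1 0 one_ne_zero ?_
    intro k hk hk'
    fin_cases k <;> simp [ofGaps, cornerLeft_halfRight, cornerRight_halfRight] at hk hk' ⊢

end Pentagon

/-! ### Lifting paths and squares -/

namespace ColouredCovering

variable {Ξ : Type u} [TopologicalSpace Ξ] (P : ColouredCovering Ξ) {n : ℕ}

variable {A : Type*} [TopologicalSpace A]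

theorem exists_lift [SimplyConnectedSpace A] [LocallyPathConnectedSpace A] (hn : 0 < n)
    (f : C(A, M (Fin n))) (a : A) (z : P.X n) (hz : P.pt z = f a) :
    ∃ F : C(A, P.X n), F a = z ∧ ∀ b, P.pt (F b) = f b := by
  obtain ⟨F, ⟨hFa, hF⟩, -⟩ := (P.isCoveringMap n hn).existsUnique_continuousMap_lifts
    -- The covering has the colours in its base, so the map to be lifted carries those of `z` as
    -- constants.
    (f.prodMk (.const A (P.inp z, P.out z))) a z (by simp [hz])
  exact ⟨F, hFa, fun b => congrArg Prod.fst (congrFun hF b)⟩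

theorem exists_lift_interval (hn : 0 < n) (f : C(I, M (Fin n))) (a : I) (z : P.X n)
    (hz : P.pt z = f a) : ∃ F : C(I, P.X n), F a = z ∧ ∀ b, P.pt (F b) = f b := by
  obtain ⟨F, hFa, hF⟩ := P.exists_lift hn
    -- Extend the path to the real line by constants, lift there, and restrict again.
    (f.comp ⟨Set.projIcc (0 : ℝ) 1 zero_le_one, continuous_projIcc⟩) (a : ℝ) z (by simp [hz])
  exact ⟨F.comp ⟨Subtype.val, continuous_subtype_val⟩, hFa, fun b => by simp [hF]⟩

theorem exists_lift_square (hn : 0 < n) (f : C(I × I, M (Fin n))) (a : I × I) (z : P.X n)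
    (hz : P.pt z = f a) : ∃ F : C(I × I, P.X n), F a = z ∧ ∀ b, P.pt (F b) = f b := by
  let proj : C(ℝ, I) := ⟨Set.projIcc (0 : ℝ) 1 zero_le_one, continuous_projIcc⟩
  let incl : C(I, ℝ) := ⟨Subtype.val, continuous_subtype_val⟩
  obtain ⟨F, hFa, hF⟩ := P.exists_lift hn (f.comp (proj.prodMap proj)) ((a.1, a.2) : ℝ × ℝ) z
    (by simp [hz, proj])
  refine ⟨F.comp (incl.prodMap incl), hFa, fun b => ?_⟩
  obtain ⟨b, c⟩ := b
  simp [hF, proj, incl]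

variable [DiscreteTopology Ξ]

theorem inp_eq_of_continuous [PreconnectedSpace A] (hn : 0 < n) {F : A → P.X n} (hF : Continuous F)
    (a b : A) : P.inp (F a) = P.inp (F b) :=
  PreconnectedSpace.constant ‹_› (((P.isCoveringMap n hn).continuous.comp hF).snd.fst)

theorem out_eq_of_continuous [PreconnectedSpace A] (hn : 0 < n) {F : A → P.X n} (hF : Continuous F)
    (a b : A) : P.out (F a) = P.out (F b) :=
  PreconnectedSpace.constant ‹_› (((P.isCoveringMap n hn).continuous.comp hF).snd.snd)

/-- Only the underlying curves need to be compared: colours are constant on a connected space, so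
they agree everywhere once they agree at `a`. -/
theorem lift_unique [PreconnectedSpace A] (hn : 0 < n) {F G : A → P.X n} (hF : Continuous F)
    (hG : Continuous G) (h : ∀ a, P.pt (F a) = P.pt (G a)) {a : A} (ha : F a = G a) : F = G := by
  refine (P.isCoveringMap n hn).eq_of_comp_eq hF hG (funext fun b => ?_) a ha
  simp only [Function.comp_apply, h b, P.inp_eq_of_continuous hn hF b a,
    P.out_eq_of_continuous hn hF b a, P.inp_eq_of_continuous hn hG b a,
    P.out_eq_of_continuous hn hG b a, ha]

end ColouredCovering

/-! ### Operadic composition as a relation -/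

namespace OperadicCovering

variable {Ξ : Type u} [TopologicalSpace Ξ] (P : OperadicCovering Ξ)

/-- `z` is the composition of `x` with the elements of the family `Y`. -/
def IsComp {n N : ℕ} (x : P.X n) (Y : Fin n → Σ k, P.X k) (z : P.X N) : Prop :=
  ∃ (h : ∑ i, (Y i).1 = N) (hc : P.Composable x fun i => (Y i).2),
    P.Γ h x (fun i => (Y i).2) hc = z

variable {P}

namespace IsComp

variable {n N : ℕ} {x : P.X n} {Y : Fin n → Σ k, P.X k} {z : P.X N}

theorem congr {Y' : Fin n → Σ k, P.X k} (h : P.IsComp x Y z) (hY : ∀ i, Y i = Y' i) :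
    P.IsComp x Y' z := by
  rwa [← show Y = Y' from funext hY]

theorem pos (h : P.IsComp x Y z) : 0 < N := by
  obtain ⟨rfl, hc, -⟩ := h
  exact Finset.sum_pos (fun i _ => hc.pos_block i) ⟨⟨0, hc.pos⟩, Finset.mem_univ _⟩

theorem out_eq (h : P.IsComp x Y z) : P.out z = P.out x := by
  obtain ⟨h, hc, rfl⟩ := h
  exact P.out_Γ _ _ _ _

theorem inp_eq (h : P.IsComp x Y z) (hs : ∑ i, (Y i).1 = N) (i : Fin n) (a : Fin (Y i).1) :
    P.inp z (blockEquiv hs ⟨i, a⟩) = P.inp (Y i).2 a := by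
  obtain ⟨h, hc, rfl⟩ := h
  exact P.inp_Γ _ _ _ _ _ _

theorem colour (h : P.IsComp x Y z) (i : Fin n) : P.out (Y i).2 = P.inp x i := h.2.1.colour i

theorem pt_eq {k : Fin n → ℕ} {y : ∀ i, P.X (k i)} (h : P.IsComp x Y z) (hs : ∑ i, k i = N)
    (hY : ∀ i, Y i = ⟨k i, y i⟩) :
    P.pt z = glue (blockEquiv hs) (P.pt x) fun i => P.pt (y i) := by
  obtain rfl : Y = fun i => ⟨k i, y i⟩ := funext hY
  obtain ⟨h, hc, rfl⟩ := h
  exact P.pt_Γ _ _ _ _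

theorem exists_of_colour (hn : 0 < n) (hY : ∀ i, 0 < (Y i).1) (hs : ∑ i, (Y i).1 = N)
    (hc : ∀ i, P.out (Y i).2 = P.inp x i) : ∃ z : P.X N, P.IsComp x Y z :=
  ⟨_, hs, ⟨hn, hY, hc⟩, rfl⟩

theorem unique {z' : P.X N} (h : P.IsComp x Y z) (h' : P.IsComp x Y z') : z = z' := by
  obtain ⟨h, hc, rfl⟩ := h
  obtain ⟨h', hc', rfl⟩ := h'
  rfl

theorem injective {x' : P.X n} {Y' : Fin n → Σ k, P.X k} (h : P.IsComp x Y z)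
    (h' : P.IsComp x' Y' z) (hk : ∀ i, (Y i).1 = (Y' i).1) : x = x' ∧ Y = Y' := by
  obtain ⟨k, y, rfl⟩ : ∃ (k : Fin n → ℕ) (y : ∀ i, P.X (k i)), Y = fun i => ⟨k i, y i⟩ :=
    ⟨fun i => (Y i).1, fun i => (Y i).2, rfl⟩
  obtain ⟨k', y', rfl⟩ : ∃ (k : Fin n → ℕ) (y : ∀ i, P.X (k i)), Y' = fun i => ⟨k i, y i⟩ :=
    ⟨fun i => (Y' i).1, fun i => (Y' i).2, rfl⟩
  obtain rfl : k = k' := funext hk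
  obtain ⟨h, hc, rfl⟩ := h
  obtain ⟨h', hc', e⟩ := h'
  obtain ⟨rfl, e'⟩ := P.Γ_injective _ _ _ _ _ _ _ e
  obtain rfl : y' = y := e'
  exact ⟨rfl, rfl⟩

/-- As an equivalence it serves to re-bracket in either direction. Families with values in `Σ k, P.X
k` keep the arities out of the types, so the reindexing by `blockEquiv` is a plain equality (`hW`).
-/
theorem assoc {m : ℕ} {u : P.X m} {W : Fin m → Σ k, P.X k} {Z : Fin n → Σ k, P.X k}
    (hs : ∑ i, (Y i).1 = m) (hu : P.IsComp x Y u)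
    (hZ : ∀ i, P.IsComp (Y i).2 (fun j => W (blockEquiv hs ⟨i, j⟩)) (Z i).2) :
    P.IsComp u W z ↔ P.IsComp x Z z := by
  have hW : ∀ p, W (blockEquiv hs ⟨((blockEquiv hs).symm p).1, ((blockEquiv hs).symm p).2⟩) = W p :=
    fun p => by rw [Sigma.eta, Equiv.apply_symm_apply]
  obtain ⟨_, hxy, rfl⟩ := id hu
  choose hs' hyz hZe using hZ
  have hsum : ∑ p, (W p).1 = ∑ i, (Z i).1 := by
    rw [← (blockEquiv hs).sum_comp, Fintype.sum_sigma]
    exact Finset.sum_congr rfl fun i _ => hs' i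
  have key : ∀ (h' : ∑ i, (Z i).1 = N)
      (h₁ : P.Composable (P.Γ hs x (fun i => (Y i).2) hxy) fun p =>
        (W (blockEquiv hs ⟨((blockEquiv hs).symm p).1, ((blockEquiv hs).symm p).2⟩)).2)
      (h₂ : P.Composable x fun i => P.Γ (hs' i) (Y i).2
        (fun j => (W (blockEquiv hs ⟨i, j⟩)).2) (hyz i)),
      P.Γ (by simp only [hW, hsum, h']) (P.Γ hs x (fun i => (Y i).2) hxy) (fun p =>
        (W (blockEquiv hs ⟨((blockEquiv hs).symm p).1, ((blockEquiv hs).symm p).2⟩)).2) h₁ =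
      P.Γ h' x (fun i => P.Γ (hs' i) (Y i).2
        (fun j => (W (blockEquiv hs ⟨i, j⟩)).2) (hyz i)) h₂ := fun h' h₁ h₂ =>
    P.Γ_assoc (r := fun i j => (W (blockEquiv hs ⟨i, j⟩)).1) hs _ hs' h' x _
      (fun i j => (W (blockEquiv hs ⟨i, j⟩)).2) hxy hyz h₁ h₂
  have hZ2 : ∀ i, P.Γ (hs' i) (Y i).2 (fun j => (W (blockEquiv hs ⟨i, j⟩)).2) (hyz i) = (Z i).2 :=
    hZe
  have hpos : ∀ i, 0 < (Z i).1 := fun i => pos ⟨hs' i, hyz i, hZe i⟩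
  have hcol : ∀ i, P.out (Z i).2 = P.inp x i := fun i => by
    rw [← hZ2, P.out_Γ]
    exact hxy.colour i
  have hc₂ : P.Composable x fun i => P.Γ (hs' i) (Y i).2
        (fun j => (W (blockEquiv hs ⟨i, j⟩)).2) (hyz i) := by
    refine ⟨hxy.pos, hpos, fun i => ?_⟩
    rw [hZ2, hcol]
  have hc₁ : P.Composable (P.Γ hs x (fun i => (Y i).2) hxy) fun p =>
        (W (blockEquiv hs ⟨((blockEquiv hs).symm p).1, ((blockEquiv hs).symm p).2⟩)).2 := by
    refine ⟨hu.pos, fun p => (hyz _).pos_block _, fun p => ?_⟩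
    have e := P.inp_Γ hs x (fun i => (Y i).2) hxy ((blockEquiv hs).symm p).1
      ((blockEquiv hs).symm p).2
    rw [Sigma.eta, Equiv.apply_symm_apply] at e
    rw [(hyz _).colour, e]
  constructor
  · intro h
    obtain ⟨h', hc', e⟩ := congr h fun p => (hW p).symm
    refine congr (Y := fun i => ⟨(Z i).1, P.Γ (hs' i) (Y i).2
        (fun j => (W (blockEquiv hs ⟨i, j⟩)).2) (hyz i)⟩) ?_ fun i => by rw [hZ2]
    exact ⟨hsum ▸ h.1, hc₂, (key _ hc₁ hc₂).symm.trans e⟩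
  · intro h
    obtain ⟨h', hc', e⟩ := congr h (Y' := fun i => ⟨(Z i).1, P.Γ (hs' i) (Y i).2
        (fun j => (W (blockEquiv hs ⟨i, j⟩)).2) (hyz i)⟩) fun i => by rw [hZ2]
    exact congr ⟨_, hc₁, (key h.1 hc₁ hc₂).trans e⟩ hW

theorem smul {h : ∑ i, (Y i).1 = N} (hz : P.IsComp x Y z) (w : Equiv.Perm (Fin n))
    (v : ∀ i, Equiv.Perm (Fin (Y i).1)) (h' : ∑ j, (Y (w.symm j)).1 = N)
    {p : Equiv.Perm (Fin N)} (hp : ∀ i, blockPerm h w h' v i = p i) :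
    P.IsComp (w • x) (fun j => ⟨(Y (w.symm j)).1, v (w.symm j) • (Y (w.symm j)).2⟩)
      (p • z) := by
  obtain rfl := Equiv.ext hp
  obtain ⟨_, hc, rfl⟩ := hz
  have hc' : P.Composable (w • x) fun j => v (w.symm j) • (Y (w.symm j)).2 := by
    refine ⟨hc.pos, fun j => hc.pos_block _, fun j => ?_⟩
    rw [P.out_smul (hc.pos_block _), hc.colour]
    conv_rhs => rw [← w.apply_symm_apply j]
    rw [P.inp_smul hc.pos]
  exact ⟨h', hc', P.Γ_smul h w h' v x (fun i => (Y i).2) hc hc'⟩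

theorem one_left (y : P.X n) (hn : 0 < n) {l : Ξ} (hl : P.out y = l) :
    P.IsComp (P.one l) ![⟨n, y⟩] y := by
  subst hl
  have h : P.IsComp (P.one (P.out y)) (fun _ => ⟨n, y⟩) y :=
    ⟨by simp, ⟨one_pos, fun _ => hn, fun i => (P.inp_one _ _).symm⟩, P.one_Γ _ _ _⟩
  exact h.congr fun i => by fin_cases i; rfl

theorem one_right (x : P.X n) (hn : 0 < n) :
    P.IsComp x (fun i => ⟨1, P.one (P.inp x i)⟩) x :=
  ⟨by simp, ⟨hn, fun _ => one_pos, fun i => P.out_one _⟩, P.Γ_one _ _ _⟩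

theorem one_right_two (x : P.X 2) :
    P.IsComp x ![⟨1, P.one (P.inp x 0)⟩, ⟨1, P.one (P.inp x 1)⟩] x :=
  (one_right x two_pos).congr fun i => by fin_cases i <;> rfl

theorem assoc_left {x y : P.X 2} {o : P.X 1} {u : P.X 3} {w₀ w₁ w₂ z₀ z₁ : Σ k, P.X k}
    (hu : P.IsComp x ![⟨2, y⟩, ⟨1, o⟩] u) (h₀ : P.IsComp y ![w₀, w₁] z₀.2)
    (h₁ : P.IsComp o ![w₂] z₁.2) :
    P.IsComp u ![w₀, w₁, w₂] z ↔ P.IsComp x ![z₀, z₁] z := by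
  refine assoc rfl hu (Fin.forall_fin_two.2 ⟨h₀.congr ?_, h₁.congr ?_⟩)
  · intro i
    fin_cases i <;> rfl
  · intro i
    fin_cases i
    rfl

theorem assoc_right {x y : P.X 2} {o : P.X 1} {u : P.X 3} {w₀ w₁ w₂ z₀ z₁ : Σ k, P.X k}
    (hu : P.IsComp x ![⟨1, o⟩, ⟨2, y⟩] u) (h₀ : P.IsComp o ![w₀] z₀.2)
    (h₁ : P.IsComp y ![w₁, w₂] z₁.2) :
    P.IsComp u ![w₀, w₁, w₂] z ↔ P.IsComp x ![z₀, z₁] z := by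
  refine assoc rfl hu (Fin.forall_fin_two.2 ⟨h₀.congr ?_, h₁.congr ?_⟩)
  · intro i
    fin_cases i
    rfl
  · intro i
    fin_cases i <;> rfl

/-- If a path in the covering lies over a path of glued curves and starts at a composition, it ends
at the composition of the end points. -/
theorem transport [DiscreteTopology Ξ] {k : Fin n → ℕ} {h : ∑ i, k i = N} (x : C(I, P.X n))
    (y : ∀ i, C(I, P.X (k i))) (F : C(I, P.X N))
    (hpt : ∀ t, P.pt (F t) = glue (blockEquiv h) (P.pt (x t)) fun i => P.pt (y i t))
    {x₀ x₁ : P.X n} {z₀ z₁ : P.X N} {Y₀ Y₁ : Fin n → Σ k, P.X k} (hx₀ : x 0 = x₀) (hx₁ : x 1 = x₁)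
    (hF₀ : F 0 = z₀) (hF₁ : F 1 = z₁) (hY₀ : ∀ i, Y₀ i = ⟨k i, y i 0⟩)
    (hY₁ : ∀ i, Y₁ i = ⟨k i, y i 1⟩) (h0 : P.IsComp x₀ Y₀ z₀) : P.IsComp x₁ Y₁ z₁ := by
  subst hx₀ hx₁ hF₀ hF₁
  obtain rfl := funext hY₀
  obtain rfl := funext hY₁
  have hN := h0.pos
  obtain ⟨_, hc0, e0⟩ := h0
  have hc : ∀ t, P.Composable (x t) fun i => y i t := fun t => by
    refine ⟨hc0.pos, hc0.pos_block, fun i => ?_⟩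
    rw [P.out_eq_of_continuous (hc0.pos_block i) (y i).continuous t 0, hc0.colour,
      P.inp_eq_of_continuous hc0.pos x.continuous t 0]
  have hG : Continuous fun t => P.Γ h (x t) (fun i => y i t) (hc t) := by
    refine (P.continuous_Γ h).comp (f := fun t => ⟨(x t, fun i => y i t), hc t⟩) ?_
    exact Continuous.subtype_mk
      (x.continuous.prodMk (continuous_pi fun i => (y i).continuous)) _
  -- The composition of the moving factors lies over the same path as `F` and agrees with it at `0`.
  have := P.lift_unique hN hG F.continuous (fun t => by rw [P.pt_Γ, hpt]) e0
  exact ⟨h, hc 1, congrFun this 1⟩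

end IsComp

end OperadicCovering

/-! ### Left and right compositions, and the monodromy between them -/

namespace OperadicCovering

variable {Ξ : Type u} [TopologicalSpace Ξ] (P : OperadicCovering Ξ)

/-- `u` is the composition of `x` and `y` at the first input of `x`. -/
def IsLeft (x y : P.X 2) (u : P.X 3) : Prop :=
  P.IsComp x ![⟨2, y⟩, ⟨1, P.one (P.inp x 1)⟩] u

/-- `u` is the composition of `x` and `y` at the second input of `x`. -/
def IsRight (x y : P.X 2) (u : P.X 3) : Prop :=
  P.IsComp x ![⟨1, P.one (P.inp x 0)⟩, ⟨2, y⟩] u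

/-- The lift of the segment from `(12)3` to `1(23)` that starts at `a` ends at `a'`. -/
def Mono (a a' : P.X 3) : Prop :=
  ∃ F : C(I, P.X 3), F 0 = a ∧ F 1 = a' ∧ ∀ t, P.pt (F t) = segment t

/-- The associator on pairs of points of `X 2`. -/
def AssocRel (x y x' y' : P.X 2) : Prop :=
  ∃ a a', P.IsLeft x y a ∧ P.Mono a a' ∧ P.IsRight x' y' a'

variable {P} {x y x' y' : P.X 2} {u a a' b : P.X 3}

theorem isLeft_compLeft (h : P.out y = P.inp x 0) : P.IsLeft x y (P.compLeft x y h) :=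
  IsComp.congr (Y := fun i => ⟨![2, 1] i, match i with
      | 0 => y
      | 1 => P.one (P.inp x 1)⟩) ⟨rfl, _, rfl⟩ fun i => by fin_cases i <;> rfl

theorem isRight_compRight (h : P.out y = P.inp x 1) : P.IsRight x y (P.compRight x y h) :=
  IsComp.congr (Y := fun i => ⟨![1, 2] i, match i with
      | 0 => P.one (P.inp x 0)
      | 1 => y⟩) ⟨rfl, _, rfl⟩ fun i => by fin_cases i <;> rfl

theorem eq_one_of_out_eq {o : P.X 1} {l : Ξ} (h : P.out o = l) : o = P.one l := h ▸ P.eq_one o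

namespace IsLeft

theorem colour (h : P.IsLeft x y u) : P.out y = P.inp x 0 := IsComp.colour h 0

theorem out_eq (h : P.IsLeft x y u) : P.out u = P.out x := IsComp.out_eq h

theorem inp_zero (h : P.IsLeft x y u) : P.inp u 0 = P.inp y 0 := IsComp.inp_eq h rfl 0 (0 : Fin 2)

theorem inp_one (h : P.IsLeft x y u) : P.inp u 1 = P.inp y 1 := IsComp.inp_eq h rfl 0 (1 : Fin 2)

theorem inp_two (h : P.IsLeft x y u) : P.inp u 2 = P.inp x 1 :=
  (IsComp.inp_eq h rfl 1 (0 : Fin 1)).trans (P.inp_one _ _)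

theorem pt_eq (h : P.IsLeft x y u) : P.pt u = segment 0 := by
  rw [IsComp.pt_eq (k := ![2, 1]) (y := fun i => match i with
      | 0 => y
      | 1 => P.one (P.inp x 1)) h rfl fun i => by fin_cases i <;> rfl]
  exact (segment_zero_eq_glue _ _).symm

theorem unique (h : P.IsLeft x y a) (h' : P.IsLeft x y b) : a = b := IsComp.unique h h'

theorem injective (h : P.IsLeft x y u) (h' : P.IsLeft x' y' u) : x = x' ∧ y = y' := by
  obtain ⟨rfl, e⟩ := IsComp.injective h h' fun i => by fin_cases i <;> rfl
  exact ⟨rfl, eq_of_heq (Sigma.mk.inj (congrFun e 0)).2⟩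

end IsLeft

namespace IsRight

theorem colour (h : P.IsRight x y u) : P.out y = P.inp x 1 := IsComp.colour h 1

theorem out_eq (h : P.IsRight x y u) : P.out u = P.out x := IsComp.out_eq h

theorem inp_zero (h : P.IsRight x y u) : P.inp u 0 = P.inp x 0 :=
  (IsComp.inp_eq h rfl 0 (0 : Fin 1)).trans (P.inp_one _ _)

theorem inp_one (h : P.IsRight x y u) : P.inp u 1 = P.inp y 0 := IsComp.inp_eq h rfl 1 (0 : Fin 2)

theorem inp_two (h : P.IsRight x y u) : P.inp u 2 = P.inp y 1 := IsComp.inp_eq h rfl 1 (1 : Fin 2)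

theorem pt_eq (h : P.IsRight x y u) : P.pt u = segment 1 := by
  rw [IsComp.pt_eq (k := ![1, 2]) (y := fun i => match i with
      | 0 => P.one (P.inp x 0)
      | 1 => y) h rfl fun i => by fin_cases i <;> rfl]
  exact (segment_one_eq_glue _ _).symm

theorem unique (h : P.IsRight x y a) (h' : P.IsRight x y b) : a = b := IsComp.unique h h'

theorem injective (h : P.IsRight x y u) (h' : P.IsRight x' y' u) : x = x' ∧ y = y' := by
  obtain ⟨rfl, e⟩ := IsComp.injective h h' fun i => by fin_cases i <;> rfl
  exact ⟨rfl, eq_of_heq (Sigma.mk.inj (congrFun e 1)).2⟩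

end IsRight

/-- Gluing is surjective onto the points over `(12)3`, and the factor of arity one can only be a
unit, with colour forced by `x`. -/
theorem exists_isLeft (h : P.pt u = segment 0) : ∃ x y, P.IsLeft x y u := by
  obtain ⟨x, y, hxy, e⟩ := P.Γ_surjective (k := ![2, 1]) (N := 3) rfl two_pos (by decide) u
    ⟨_, _, h.trans segment_zero⟩
  have h1 : y 1 = P.one (P.inp x 1) := eq_one_of_out_eq (hxy.colour 1)
  have h2 : P.IsComp x (fun i => ⟨![2, 1] i, y i⟩) u := ⟨rfl, hxy, e⟩
  refine ⟨x, y 0, h2.congr (Fin.forall_fin_two.2 ⟨rfl, ?_⟩)⟩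
  rw [h1]
  rfl

theorem exists_isRight (h : P.pt u = segment 1) : ∃ x y, P.IsRight x y u := by
  obtain ⟨x, y, hxy, e⟩ := P.Γ_surjective (k := ![1, 2]) (N := 3) rfl two_pos (by decide) u
    ⟨_, _, h.trans segment_one⟩
  have h1 : y 0 = P.one (P.inp x 0) := eq_one_of_out_eq (hxy.colour 0)
  have h2 : P.IsComp x (fun i => ⟨![1, 2] i, y i⟩) u := ⟨rfl, hxy, e⟩
  refine ⟨x, y 1, h2.congr (Fin.forall_fin_two.2 ⟨?_, rfl⟩)⟩
  rw [h1]
  rfl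

theorem smul_one (l : Ξ) (w : Equiv.Perm (Fin 1)) : w • P.one l = P.one l :=
  eq_one_of_out_eq (by rw [P.out_smul one_pos, P.out_one])

theorem inp_swap_zero (x : P.X 2) : P.inp (Equiv.swap (0 : Fin 2) 1 • x) 0 = P.inp x 1 :=
  P.inp_smul two_pos _ x 1

theorem inp_swap_one (x : P.X 2) : P.inp (Equiv.swap (0 : Fin 2) 1 • x) 1 = P.inp x 0 :=
  P.inp_smul two_pos _ x 0

/-- Equivariance: transposing the two blocks and the two letters inside the larger block reverses
all three letters. -/
theorem IsRight.swap (h : P.IsRight x y u) :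
    P.IsLeft (Equiv.swap (0 : Fin 2) 1 • x) (Equiv.swap (0 : Fin 2) 1 • y)
      ((Fin.revPerm : Equiv.Perm (Fin 3)) • u) := by
  have := IsComp.smul (h := rfl) h (Equiv.swap 0 1) (fun i => match i with
    | 0 => (1 : Equiv.Perm (Fin 1))
    | 1 => (Equiv.swap 0 1 : Equiv.Perm (Fin 2))) rfl (p := Fin.revPerm) (fun i => by fin_cases i <;> rfl)
  refine this.congr (Fin.forall_fin_two.2 ⟨rfl, ?_⟩)
  rw [inp_swap_one]
  exact congrArg (Sigma.mk 1) (smul_one (P := P) (P.inp x 0) 1)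

theorem IsLeft.swap (h : P.IsLeft x y u) :
    P.IsRight (Equiv.swap (0 : Fin 2) 1 • x) (Equiv.swap (0 : Fin 2) 1 • y)
      ((Fin.revPerm : Equiv.Perm (Fin 3)) • u) := by
  have := IsComp.smul (h := rfl) h (Equiv.swap 0 1) (fun i => match i with
    | 0 => (Equiv.swap 0 1 : Equiv.Perm (Fin 2))
    | 1 => (1 : Equiv.Perm (Fin 1))) rfl (p := Fin.revPerm) (fun i => by fin_cases i <;> rfl)
  refine this.congr (Fin.forall_fin_two.2 ⟨?_, rfl⟩)
  rw [inp_swap_zero]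
  exact congrArg (Sigma.mk 1) (smul_one (P := P) (P.inp x 1) 1)

/-- Apply the reversal to the lift and run it backwards; by `relabel_rev_segment` it again lies over
`segment`. -/
theorem Mono.rev (h : P.Mono a a') :
    P.Mono ((Fin.revPerm : Equiv.Perm (Fin 3)) • a') ((Fin.revPerm : Equiv.Perm (Fin 3)) • a) := by
  obtain ⟨F, rfl, rfl, hF⟩ := h
  refine ⟨⟨fun t => (Fin.revPerm : Equiv.Perm (Fin 3)) • F (σ t), ?_⟩, ?_, ?_, fun t => ?_⟩
  · exact (P.continuous_smul 3 three_pos _).comp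
      (F.continuous.comp unitInterval.continuous_symm)
  · simp
  · simp
  · exact (P.pt_smul three_pos _ _).trans (by rw [hF, relabel_rev_segment])

/-- This is the hexagon axiom on points of `X 2`. -/
theorem AssocRel.swap (h : P.AssocRel x y x' y') :
    P.AssocRel (Equiv.swap (0 : Fin 2) 1 • x') (Equiv.swap (0 : Fin 2) 1 • y')
      (Equiv.swap (0 : Fin 2) 1 • x) (Equiv.swap (0 : Fin 2) 1 • y) := by
  obtain ⟨a, a', h1, h2, h3⟩ := h
  exact ⟨_, _, h3.swap, h2.rev, h1.swap⟩

namespace Mono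

theorem pt_left (h : P.Mono a a') : P.pt a = segment 0 := by
  obtain ⟨F, rfl, rfl, hF⟩ := h
  exact hF 0

theorem pt_right (h : P.Mono a a') : P.pt a' = segment 1 := by
  obtain ⟨F, rfl, rfl, hF⟩ := h
  exact hF 1

end Mono

theorem exists_mono_left (h : P.pt a = segment 0) : ∃ a', P.Mono a a' := by
  obtain ⟨F, h0, hF⟩ := P.exists_lift_interval three_pos segment 0 a h
  exact ⟨_, F, h0, rfl, hF⟩

theorem exists_mono_right (h : P.pt a' = segment 1) : ∃ a, P.Mono a a' := by
  obtain ⟨F, h1, hF⟩ := P.exists_lift_interval three_pos segment 1 a' h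
  exact ⟨_, F, rfl, h1, hF⟩

namespace AssocRel

theorem colour_left (h : P.AssocRel x y x' y') : P.out y = P.inp x 0 := by
  obtain ⟨a, a', h1, -, -⟩ := h
  exact h1.colour

theorem colour_right (h : P.AssocRel x y x' y') : P.out y' = P.inp x' 1 := by
  obtain ⟨a, a', -, -, h3⟩ := h
  exact h3.colour

end AssocRel

theorem exists_assocRel_left (h : P.out y = P.inp x 0) : ∃ x' y', P.AssocRel x y x' y' := by
  have h1 := isLeft_compLeft h
  obtain ⟨a', h2⟩ := exists_mono_left h1.pt_eq
  obtain ⟨x', y', h3⟩ := exists_isRight h2.pt_right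
  exact ⟨x', y', _, _, h1, h2, h3⟩

theorem exists_assocRel_right (h : P.out y' = P.inp x' 1) : ∃ x y, P.AssocRel x y x' y' := by
  have h3 := isRight_compRight h
  obtain ⟨a, h2⟩ := exists_mono_right h3.pt_eq
  obtain ⟨x, y, h1⟩ := exists_isLeft h2.pt_left
  exact ⟨x, y, _, _, h1, h2, h3⟩

/-! ### Two descriptions of each vertex of the pentagon -/

section Compositions

variable {z : P.X 2} {v : P.X 4}

/-- A vertex lies on two sides, and a transport along a side needs the composition adapted to it.
This lemma and the next three switch between sides at the vertices `((12)3)4`, `(1(23))4`,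
`1((23)4)` and `1(2(34))`. -/
theorem IsLeft.isLeft_iff
    (h : P.IsLeft x y u) (h' : P.IsLeft y z a) :
    P.IsComp u ![⟨2, z⟩, ⟨1, P.one (P.inp y 1)⟩, ⟨1, P.one (P.inp x 1)⟩] v ↔
      P.IsComp x ![⟨3, a⟩, ⟨1, P.one (P.inp x 1)⟩] v :=
  IsComp.assoc_left (z₀ := ⟨3, a⟩) (z₁ := ⟨1, _⟩) h h'
    (IsComp.one_left _ one_pos (P.out_one _))

theorem IsLeft.isRight_iff
    (h : P.IsLeft x y u) (h' : P.IsRight y z a) :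
    P.IsComp u ![⟨1, P.one (P.inp y 0)⟩, ⟨2, z⟩, ⟨1, P.one (P.inp x 1)⟩] v ↔
      P.IsComp x ![⟨3, a⟩, ⟨1, P.one (P.inp x 1)⟩] v :=
  IsComp.assoc_left (z₀ := ⟨3, a⟩) (z₁ := ⟨1, _⟩) h h'
    (IsComp.one_left _ one_pos (P.out_one _))

theorem IsRight.isLeft_iff
    (h : P.IsRight x y u) (h' : P.IsLeft y z a) :
    P.IsComp u ![⟨1, P.one (P.inp x 0)⟩, ⟨2, z⟩, ⟨1, P.one (P.inp y 1)⟩] v ↔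
      P.IsComp x ![⟨1, P.one (P.inp x 0)⟩, ⟨3, a⟩] v :=
  IsComp.assoc_right (z₀ := ⟨1, _⟩) (z₁ := ⟨3, a⟩) h 
    (IsComp.one_left _ one_pos (P.out_one _)) h'

theorem IsRight.isRight_iff
    (h : P.IsRight x y u) (h' : P.IsRight y z a) :
    P.IsComp u ![⟨1, P.one (P.inp x 0)⟩, ⟨1, P.one (P.inp y 0)⟩, ⟨2, z⟩] v ↔
      P.IsComp x ![⟨1, P.one (P.inp x 0)⟩, ⟨3, a⟩] v :=
  IsComp.assoc_right (z₀ := ⟨1, _⟩) (z₁ := ⟨3, a⟩) h 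
    (IsComp.one_left _ one_pos (P.out_one _)) h'

/-- At the remaining vertex `(12)(34)` both adjacent descriptions reduce to composing `x` with two
elements of `X 2`. -/
theorem IsRight.comp_two_iff
    (h : P.IsRight x y u) (h' : P.out z = P.inp x 0) :
    P.IsComp u ![⟨2, z⟩, ⟨1, P.one (P.inp y 0)⟩, ⟨1, P.one (P.inp y 1)⟩] v ↔
      P.IsComp x ![⟨2, z⟩, ⟨2, y⟩] v :=
  IsComp.assoc_right (z₀ := ⟨2, z⟩) (z₁ := ⟨2, y⟩) h 
    (IsComp.one_left z two_pos h') (IsComp.one_right_two y)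

theorem IsLeft.comp_two_iff
    (h : P.IsLeft x y u) (h' : P.out z = P.inp x 1) :
    P.IsComp u ![⟨1, P.one (P.inp y 0)⟩, ⟨1, P.one (P.inp y 1)⟩, ⟨2, z⟩] v ↔
      P.IsComp x ![⟨2, y⟩, ⟨2, z⟩] v :=
  IsComp.assoc_left (z₀ := ⟨2, y⟩) (z₁ := ⟨2, z⟩) h 
    (IsComp.one_right_two y) (IsComp.one_left z two_pos h')

end Compositions

variable [DiscreteTopology Ξ]

namespace Mono

theorem inp_eq (h : P.Mono a a') : P.inp a = P.inp a' := by
  obtain ⟨F, rfl, rfl, hF⟩ := h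
  exact P.inp_eq_of_continuous three_pos F.continuous _ _

theorem out_eq (h : P.Mono a a') : P.out a = P.out a' := by
  obtain ⟨F, rfl, rfl, hF⟩ := h
  exact P.out_eq_of_continuous three_pos F.continuous _ _

theorem right_unique (h : P.Mono a a') (h' : P.Mono a b) : a' = b := by
  obtain ⟨F, h0, rfl, hF⟩ := h
  obtain ⟨G, h0', rfl, hG⟩ := h'
  exact congrFun (P.lift_unique three_pos F.continuous G.continuous
    (fun t => (hF t).trans (hG t).symm) (h0.trans h0'.symm)) 1

theorem left_unique (h : P.Mono a a') (h' : P.Mono b a') : a = b := by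
  obtain ⟨F, rfl, h1, hF⟩ := h
  obtain ⟨G, rfl, h1', hG⟩ := h'
  exact congrFun (P.lift_unique three_pos F.continuous G.continuous
    (fun t => (hF t).trans (hG t).symm) (h1.trans h1'.symm)) 0

end Mono

namespace AssocRel

variable {x₁ y₁ : P.X 2}

theorem out_eq (h : P.AssocRel x y x' y') : P.out x = P.out x' := by
  obtain ⟨a, a', h1, h2, h3⟩ := h
  rw [← h1.out_eq, h2.out_eq, h3.out_eq]

theorem inp_zero (h : P.AssocRel x y x' y') : P.inp y 0 = P.inp x' 0 := by
  obtain ⟨a, a', h1, h2, h3⟩ := h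
  rw [← h1.inp_zero, h2.inp_eq, h3.inp_zero]

theorem inp_one (h : P.AssocRel x y x' y') : P.inp y 1 = P.inp y' 0 := by
  obtain ⟨a, a', h1, h2, h3⟩ := h
  rw [← h1.inp_one, h2.inp_eq, h3.inp_one]

theorem inp_two (h : P.AssocRel x y x' y') : P.inp x 1 = P.inp y' 1 := by
  obtain ⟨a, a', h1, h2, h3⟩ := h
  rw [← h1.inp_two, h2.inp_eq, h3.inp_two]

theorem right_unique (h : P.AssocRel x y x' y') (h' : P.AssocRel x y x₁ y₁) :
    x' = x₁ ∧ y' = y₁ := by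
  obtain ⟨a, a', h1, h2, h3⟩ := h
  obtain ⟨b, b', h1', h2', h3'⟩ := h'
  obtain rfl := h1.unique h1'
  obtain rfl := h2.right_unique h2'
  exact h3.injective h3'

theorem left_unique (h : P.AssocRel x y x' y') (h' : P.AssocRel x₁ y₁ x' y') :
    x = x₁ ∧ y = y₁ := by
  obtain ⟨a, a', h1, h2, h3⟩ := h
  obtain ⟨b, b', h1', h2', h3'⟩ := h'
  obtain rfl := h3.unique h3'
  obtain rfl := h2.left_unique h2'
  exact h1.injective h1'

end AssocRel

/-! ### The pentagon axiom for points of the covering -/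

section Pentagon

variable {F : C(I × I, P.X 4)}

/-- Each side of the lifted square moves one factor by `Mono` and keeps the others fixed. This side
is run from `r = 1` to `r = 0`. -/
theorem transport_left (hF : ∀ t, P.pt (F t) = pentagon t) {o : P.X 1}
    (h : P.IsComp x ![⟨3, a⟩, ⟨1, o⟩] (F (1, 0))) (ha : P.Mono a a') :
    P.IsComp x ![⟨3, a'⟩, ⟨1, o⟩] (F (0, 0)) := by
  obtain ⟨G, rfl, rfl, hG⟩ := ha
  exact IsComp.transport (k := ![3, 1]) (N := 4) (h := rfl) (.const I x)
    (fun i => match i with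
      | 0 => G
      | 1 => .const I o)
    (F.comp ⟨fun t => (σ t, 0), by fun_prop⟩)
    (fun t => (hF _).trans (pentagon_left t _ _ (hG t)))
    rfl rfl (by simp) (by simp)
    (Fin.forall_fin_two.2 ⟨rfl, rfl⟩)
    (Fin.forall_fin_two.2 ⟨rfl, rfl⟩) h

theorem transport_right (hF : ∀ t, P.pt (F t) = pentagon t) {o : P.X 1}
    (h : P.IsComp x ![⟨1, o⟩, ⟨3, a⟩] (F (0, 1))) (ha : P.Mono a a') :
    P.IsComp x ![⟨1, o⟩, ⟨3, a'⟩] (F (1, 1)) := by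
  obtain ⟨G, rfl, rfl, hG⟩ := ha
  exact IsComp.transport (k := ![1, 3]) (N := 4) (h := rfl) (.const I x)
    (fun i => match i with
      | 0 => .const I o
      | 1 => G)
    (F.comp ⟨fun t => (t, 1), by fun_prop⟩)
    (fun t => (hF _).trans (pentagon_right t _ _ (hG t)))
    rfl rfl rfl rfl
    (Fin.forall_fin_two.2 ⟨rfl, rfl⟩)
    (Fin.forall_fin_two.2 ⟨rfl, rfl⟩) h

theorem transport_bottom (hF : ∀ t, P.pt (F t) = pentagon t) {z : P.X 2} {o o' : P.X 1}
    (h : P.IsComp a ![⟨1, o⟩, ⟨2, z⟩, ⟨1, o'⟩] (F (0, 0))) (ha : P.Mono a a') :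
    P.IsComp a' ![⟨1, o⟩, ⟨2, z⟩, ⟨1, o'⟩] (F (0, 1)) := by
  obtain ⟨G, rfl, rfl, hG⟩ := ha
  exact IsComp.transport (k := ![1, 2, 1]) (N := 4) (h := rfl) (G.comp cornerRatio)
    (fun i => match i with
      | 0 => .const I o
      | 1 => .const I z
      | 2 => .const I o')
    (F.comp ⟨fun t => (0, t), by fun_prop⟩)
    (fun t => (hF _).trans (pentagon_bottom t _ _ (hG _)))
    (by simp [cornerRatio_zero]) (by simp [cornerRatio_one]) rfl rfl
    (Fin.forall_fin_succ.2 ⟨rfl, Fin.forall_fin_two.2 ⟨rfl, rfl⟩⟩)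
    (Fin.forall_fin_succ.2 ⟨rfl, Fin.forall_fin_two.2 ⟨rfl, rfl⟩⟩) h

theorem transport_top_left (hF : ∀ t, P.pt (F t) = pentagon t) {z : P.X 2} {o o' : P.X 1}
    (h : P.IsComp a ![⟨2, z⟩, ⟨1, o⟩, ⟨1, o'⟩] (F (1, 0))) (ha : P.Mono a a') :
    P.IsComp a' ![⟨2, z⟩, ⟨1, o⟩, ⟨1, o'⟩] (F (1, halfLeft 1)) := by
  obtain ⟨G, rfl, rfl, hG⟩ := ha
  exact IsComp.transport (k := ![2, 1, 1]) (N := 4) (h := rfl) G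
    (fun i => match i with
      | 0 => .const I z
      | 1 => .const I o
      | 2 => .const I o')
    (F.comp ⟨fun t => (1, halfLeft t), by fun_prop⟩)
    (fun t => (hF _).trans (pentagon_top_left t _ _ (hG _)))
    rfl rfl (by simp [halfLeft_zero]) rfl
    (Fin.forall_fin_succ.2 ⟨rfl, Fin.forall_fin_two.2 ⟨rfl, rfl⟩⟩)
    (Fin.forall_fin_succ.2 ⟨rfl, Fin.forall_fin_two.2 ⟨rfl, rfl⟩⟩) h

theorem transport_top_right (hF : ∀ t, P.pt (F t) = pentagon t) {z : P.X 2} {o o' : P.X 1}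
    (h : P.IsComp a ![⟨1, o⟩, ⟨1, o'⟩, ⟨2, z⟩] (F (1, halfLeft 1))) (ha : P.Mono a a') :
    P.IsComp a' ![⟨1, o⟩, ⟨1, o'⟩, ⟨2, z⟩] (F (1, 1)) := by
  obtain ⟨G, rfl, rfl, hG⟩ := ha
  exact IsComp.transport (k := ![1, 1, 2]) (N := 4) (h := rfl) G
    (fun i => match i with
      | 0 => .const I o
      | 1 => .const I o'
      | 2 => .const I z)
    (F.comp ⟨fun t => (1, halfRight t), by fun_prop⟩)
    (fun t => (hF _).trans (pentagon_top_right t _ _ (hG _)))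
    rfl rfl (by simp [halfRight_zero]) (by simp [halfRight_one])
    (Fin.forall_fin_succ.2 ⟨rfl, Fin.forall_fin_two.2 ⟨rfl, rfl⟩⟩)
    (Fin.forall_fin_succ.2 ⟨rfl, Fin.forall_fin_two.2 ⟨rfl, rfl⟩⟩) h

/-- The pentagon axiom on points of `X 2`. -/
theorem AssocRel.pentagon {x y z y₁ z₁ x₂ y₂ y₃ z₃ x' y' x'' z'' : P.X 2}
    (h₁ : P.AssocRel y z y₁ z₁) (h₂ : P.AssocRel x y₁ x₂ y₂) (h₃ : P.AssocRel y₂ z₁ y₃ z₃)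
    (k₁ : P.AssocRel x y x' y') (k₂ : P.AssocRel x' z x'' z'') :
    x₂ = x'' ∧ y₃ = z'' ∧ z₃ = y' := by
  have hxy := k₁.colour_left
  have hz := k₂.colour_left
  have hy' := k₁.colour_right
  have hr := isRight_compRight (h₃.out_eq ▸ h₂.colour_right)
  have h₂0 := h₂.inp_zero
  have h₂2 := h₂.inp_two
  have k₁1 := k₁.inp_one
  have k₁2 := k₁.inp_two
  obtain ⟨a, a', ha, hm, ha'⟩ := h₁
  obtain ⟨b, b', hb, hbm, hb'⟩ := h₂
  obtain ⟨c, c', hc, hcm, hc'⟩ := h₃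
  obtain ⟨d, d', hd, hdm, hd'⟩ := k₁
  obtain ⟨e, e', he, hem, he'⟩ := k₂
  -- The common starting point, over `((12)3)4`, from which the square is lifted.
  obtain ⟨V, hV⟩ : ∃ V : P.X 4, P.IsComp x ![⟨3, a⟩, ⟨1, P.one (P.inp x 1)⟩] V :=
    IsComp.exists_of_colour two_pos (Fin.forall_fin_two.2 ⟨three_pos, one_pos⟩) rfl
      (Fin.forall_fin_two.2 ⟨ha.out_eq.trans hxy, P.out_one _⟩)
  have hVpt : P.pt V = RealModuli.pentagon (1, 0) := by
    rw [IsComp.pt_eq (k := ![3, 1]) (y := fun i => match i with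
      | 0 => a
      | 1 => P.one (P.inp x 1)) hV rfl (Fin.forall_fin_two.2 ⟨rfl, rfl⟩)]
    refine Eq.trans (pentagon_left 0 _ _ ha.pt_eq).symm (by simp)
  obtain ⟨F, hF0, hF⟩ := P.exists_lift_square four_pos RealModuli.pentagon (1, 0) V hVpt
  rw [← hF0] at hV
  -- The three-step route to `F (1, 1)`: left, bottom, right. The rewriting of colours makes the
  -- units match at the next vertex.
  have s := transport_bottom hF ((hb.isRight_iff ha').2 (transport_left hF hV hm)) hbm
  rw [h₂0, h₂2] at s
  have s' := (hr.isRight_iff hc').2 (transport_right hF ((hb'.isLeft_iff hc).1 s) hcm)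
  -- The two-step route along `r = 1`, through `(12)(34)`, to the same point `F (1, 1)`.
  have t := transport_top_left hF ((hd.isLeft_iff ha).2 hV) hdm
  rw [k₁1, k₁2] at t
  have t' := transport_top_right hF ((he.comp_two_iff hy').2 ((hd'.comp_two_iff hz).1 t)) hem
  obtain ⟨e₁, e₂⟩ := s'.injective t' fun i => by fin_cases i <;> rfl
  rw [e₁] at hr
  obtain ⟨e₃, e₄⟩ := hr.injective he'
  exact ⟨e₃, e₄, eq_of_heq (Sigma.mk.inj (congrFun e₂ 2)).2⟩

end Pentagon

end OperadicCovering

/-! ### From points of the covering to graded sets -/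

namespace OperadicCovering

variable {Ξ : Type u} [TopologicalSpace Ξ] {P : OperadicCovering Ξ} {A B D : Ξ → Type u} {m : Ξ}

section TensorElt

/-- The point of `X 2` that underlies an element of `A ⊗ B`. -/
def tPoint (t : P.TensorElt A B m) : P.X 2 := t.2.1.1

/-- The element of `A` that underlies an element of `A ⊗ B`. -/
def tFst (t : P.TensorElt A B m) : Σ l, A l := ⟨t.1.1, t.2.2.1⟩

/-- The element of `B` that underlies an element of `A ⊗ B`. -/
def tSnd (t : P.TensorElt A B m) : Σ l, B l := ⟨t.1.2, t.2.2.2⟩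

theorem inp_tPoint_zero (t : P.TensorElt A B m) : P.inp (tPoint t) 0 = (tFst t).1 :=
  congrFun t.2.1.2.1 0

theorem inp_tPoint_one (t : P.TensorElt A B m) : P.inp (tPoint t) 1 = (tSnd t).1 :=
  congrFun t.2.1.2.1 1

theorem out_tPoint (t : P.TensorElt A B m) : P.out (tPoint t) = m := t.2.1.2.2

/-- The degree is the output colour of the point, so it need not be compared. The version with
varying degree is needed for the inner factor of an iterated tensor product. -/
theorem sigma_tensorElt_ext {p q : Σ m, P.TensorElt A B m} (h : tPoint p.2 = tPoint q.2)
    (h₁ : tFst p.2 = tFst q.2) (h₂ : tSnd p.2 = tSnd q.2) : p = q := by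
  obtain ⟨m, ⟨l₁, l₂⟩, ⟨x, hx, rfl⟩, a, b⟩ := p
  obtain ⟨m', ⟨l₁', l₂'⟩, ⟨x', hx', rfl⟩, a', b'⟩ := q
  obtain rfl : x = x' := h
  obtain ⟨rfl, h₁⟩ := Sigma.mk.inj h₁
  obtain ⟨rfl, h₂⟩ := Sigma.mk.inj h₂
  obtain rfl := eq_of_heq h₁
  obtain rfl := eq_of_heq h₂
  rfl

theorem tensorElt_ext {s t : P.TensorElt A B m} (h : tPoint s = tPoint t)
    (h₁ : tFst s = tFst t) (h₂ : tSnd s = tSnd t) : s = t :=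
  eq_of_heq (Sigma.mk.inj (sigma_tensorElt_ext (p := ⟨m, s⟩) (q := ⟨m, t⟩) h h₁ h₂)).2

/-- The element of `A ⊗ B` with given components. -/
def tensorMk (x : P.X 2) (a : Σ l, A l) (b : Σ l, B l) (ha : P.inp x 0 = a.1)
    (hb : P.inp x 1 = b.1) (hm : P.out x = m) : P.TensorElt A B m :=
  ⟨(a.1, b.1), ⟨x, funext (Fin.forall_fin_two.2 ⟨ha, hb⟩), hm⟩, a.2, b.2⟩

end TensorElt

section Associator

/-- The associator as a relation between elements. -/
structure AssocEltRel (t : P.TensorElt (P.TensorElt A B) D m)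
    (t' : P.TensorElt A (P.TensorElt B D) m) : Prop where
  fst : tFst t' = tFst (tFst t).2
  mid : tFst (tSnd t').2 = tSnd (tFst t).2
  snd : tSnd (tSnd t').2 = tSnd t
  rel : P.AssocRel (tPoint t) (tPoint (tFst t).2) (tPoint t') (tPoint (tSnd t').2)

/-- The path from `(12)3` to `1(23)` given by the segment. -/
noncomputable def segmentPath : Path pt12_3 pt1_23 where
  toContinuousMap := segment
  source' := segment_zero
  target' := segment_one

theorem coord_pt12_3 : coord pt12_3 = 0 := by rw [← segment_zero, coord_segment]

theorem coord_pt1_23 : coord pt1_23 = 1 := by rw [← segment_one, coord_segment]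

/-- A path in the non-negative part equals `segment ∘ coord ∘ p`, so precomposing the lift of
`segment` with `coord ∘ p` lifts it with the same ends. No homotopy is needed. -/
theorem Mono.isMonodromy {a a' : P.X 3} (h : P.Mono a a') (p : Path pt12_3 pt1_23)
    (hp : ∀ s, p s ∈ positivePart 3) : P.IsMonodromy p a a' := by
  obtain ⟨F, h0, h1, hF⟩ := h
  refine ⟨⟨F.comp ⟨fun s => coord (p s), continuous_coord.comp p.continuous⟩, ?_, ?_⟩, ?_⟩
  · simp [coord_pt12_3, h0]
  · simp [coord_pt1_23, h1]
  · intro s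
    exact (hF _).trans (segment_coord (hp s))

theorem mono_of_isMonodromy {a a' : P.X 3} (h : P.IsMonodromy segmentPath a a') : P.Mono a a' := by
  obtain ⟨q, hq⟩ := h
  exact ⟨q.toContinuousMap, q.source, q.target, hq⟩

/-- The condition on all paths can be tested on `segmentPath` alone. -/
theorem isAssociator_iff (hP : P.FiniteMultiplicities) {A B D : GradedSet Ξ}
    (f : P.tensorObj hP (P.tensorObj hP A B) D ⟶ P.tensorObj hP A (P.tensorObj hP B D)) :
    P.IsAssociator hP f ↔
      ∀ m (t : P.TensorElt (P.TensorElt A.obj B.obj) D.obj m), AssocEltRel t (f m t) := by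
  constructor
  · intro h m t
    obtain ⟨h1, h2, h3, h4⟩ := h m t
    exact ⟨h1, h2, h3, P.leftPoint t, P.rightPoint (f m t), isLeft_compLeft _,
      mono_of_isMonodromy (h4 segmentPath segment_mem), isRight_compRight _⟩
  · intro h m t
    obtain ⟨h1, h2, h3, a, a', h4, h5, h6⟩ := h m t
    refine ⟨h1, h2, h3, fun p hp => ?_⟩
    obtain rfl : a = P.leftPoint t := h4.unique (isLeft_compLeft _)
    obtain rfl : a' = P.rightPoint (f m t) := h6.unique (isRight_compRight _)
    exact h5.isMonodromy p hp

variable [DiscreteTopology Ξ]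

theorem AssocEltRel.right_unique {t : P.TensorElt (P.TensorElt A B) D m}
    {s s' : P.TensorElt A (P.TensorElt B D) m} (h : AssocEltRel t s) (h' : AssocEltRel t s') :
    s = s' := by
  obtain ⟨e, e'⟩ := h.rel.right_unique h'.rel
  exact tensorElt_ext e (h.fst.trans h'.fst.symm)
    (sigma_tensorElt_ext e' (h.mid.trans h'.mid.symm) (h.snd.trans h'.snd.symm))

theorem AssocEltRel.left_unique {t t' : P.TensorElt (P.TensorElt A B) D m}
    {s : P.TensorElt A (P.TensorElt B D) m} (h : AssocEltRel t s) (h' : AssocEltRel t' s) :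
    t = t' := by
  obtain ⟨e, e'⟩ := h.rel.left_unique h'.rel
  exact tensorElt_ext e (sigma_tensorElt_ext e' (h.fst.symm.trans h'.fst)
    (h.mid.symm.trans h'.mid)) (h.snd.symm.trans h'.snd)

theorem exists_assocEltRel_left (t : P.TensorElt (P.TensorElt A B) D m) :
    ∃ t', AssocEltRel t t' := by
  obtain ⟨x', y', h⟩ := exists_assocRel_left (P := P) (x := tPoint t) (y := tPoint (tFst t).2)
    ((out_tPoint _).trans (inp_tPoint_zero t).symm)
  let s : P.TensorElt B D (P.out y') := tensorMk y' (tSnd (tFst t).2) (tSnd t)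
    (h.inp_one.symm.trans (inp_tPoint_one _)) (h.inp_two.symm.trans (inp_tPoint_one _)) rfl
  exact ⟨tensorMk x' (tFst (tFst t).2) ⟨_, s⟩ (h.inp_zero.symm.trans (inp_tPoint_zero _))
    h.colour_right.symm (h.out_eq.symm.trans (out_tPoint _)), rfl, rfl, rfl, h⟩

theorem exists_assocEltRel_right (t' : P.TensorElt A (P.TensorElt B D) m) :
    ∃ t, AssocEltRel t t' := by
  obtain ⟨x, y, h⟩ := exists_assocRel_right (P := P) (x' := tPoint t') (y' := tPoint (tSnd t').2)
    ((out_tPoint _).trans (inp_tPoint_one t').symm)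
  let s : P.TensorElt A B (P.out y) := tensorMk y (tFst t') (tFst (tSnd t').2)
    (h.inp_zero.trans (inp_tPoint_zero _)) (h.inp_one.trans (inp_tPoint_zero _)) rfl
  exact ⟨tensorMk x ⟨_, s⟩ (tSnd (tSnd t').2) h.colour_left.symm
    (h.inp_two.trans (inp_tPoint_one _)) (h.out_eq.trans (out_tPoint _)), rfl, rfl, rfl, h⟩

/-- The associator of the category of graded sets. -/
noncomputable def assocIso (hP : P.FiniteMultiplicities) (A B D : GradedSet Ξ) :
    P.tensorObj hP (P.tensorObj hP A B) D ≅ P.tensorObj hP A (P.tensorObj hP B D) where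
  hom _ t := (exists_assocEltRel_left t).choose
  inv _ t' := (exists_assocEltRel_right t').choose
  hom_inv_id := funext fun _ => funext fun t =>
    (exists_assocEltRel_right _).choose_spec.left_unique (exists_assocEltRel_left t).choose_spec
  inv_hom_id := funext fun _ => funext fun t' =>
    (exists_assocEltRel_left _).choose_spec.right_unique (exists_assocEltRel_right t').choose_spec

theorem assocEltRel_hom (hP : P.FiniteMultiplicities) (A B D : GradedSet Ξ)
    (t : P.TensorElt (P.TensorElt A.obj B.obj) D.obj m) :
    AssocEltRel t ((assocIso hP A B D).hom m t) :=
  (exists_assocEltRel_left t).choose_spec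

theorem assocEltRel_inv (hP : P.FiniteMultiplicities) (A B D : GradedSet Ξ)
    (t : P.TensorElt A.obj (P.TensorElt B.obj D.obj) m) :
    AssocEltRel ((assocIso hP A B D).inv m t) t :=
  (exists_assocEltRel_right t).choose_spec

end Associator

section Commutor

/-- The commutor on elements. -/
def commElt (t : P.TensorElt A B m) : P.TensorElt B A m :=
  tensorMk (Equiv.swap (0 : Fin 2) 1 • tPoint t) (tSnd t) (tFst t)
    ((inp_swap_zero _).trans (inp_tPoint_one t)) ((inp_swap_one _).trans (inp_tPoint_zero t))
    ((P.out_smul two_pos _ _).trans (out_tPoint t))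

theorem commElt_commElt (t : P.TensorElt A B m) : commElt (commElt t) = t := by
  refine tensorElt_ext ?_ rfl rfl
  change Equiv.swap (0 : Fin 2) 1 • Equiv.swap (0 : Fin 2) 1 • tPoint t = tPoint t
  rw [smul_smul, Equiv.swap_mul_self, one_smul]

/-- The commutor of the category of graded sets. -/
def commIso (hP : P.FiniteMultiplicities) (A B : GradedSet Ξ) :
    P.tensorObj hP A B ≅ P.tensorObj hP B A where
  hom _ t := commElt t
  inv _ t := commElt t
  hom_inv_id := funext fun _ => funext fun t => commElt_commElt t
  inv_hom_id := funext fun _ => funext fun t => commElt_commElt t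

theorem IsCommutor.apply_eq {hP : P.FiniteMultiplicities} {A B : GradedSet Ξ}
    {f : P.tensorObj hP A B ⟶ P.tensorObj hP B A} (h : P.IsCommutor hP f)
    (t : P.TensorElt A.obj B.obj m) : f m t = commElt t := by
  obtain ⟨h1, h2, h3⟩ := h m t
  exact tensorElt_ext h3 h1 h2

end Commutor

/-! ### The axioms of a coboundary category -/

variable [DiscreteTopology Ξ]

theorem assocIso_naturality (hP : P.FiniteMultiplicities) {A A' B B' D D' : GradedSet Ξ}
    (f : A ⟶ A') (g : B ⟶ B') (h : D ⟶ D') :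
    (P.tensor hP).map ((P.tensor hP).map (f ×ₘ g) ×ₘ h) ≫ (assocIso hP A' B' D').hom =
      (assocIso hP A B D).hom ≫ (P.tensor hP).map (f ×ₘ (P.tensor hP).map (g ×ₘ h)) := by
  funext m t
  have ht := assocEltRel_hom hP A B D t
  refine (assocEltRel_hom hP A' B' D' _).right_unique ⟨?_, ?_, ?_, ?_⟩
  · exact congrArg (fun p : Σ l, A.obj l => (⟨p.1, f p.1 p.2⟩ : Σ l, A'.obj l)) ht.fst
  · exact congrArg (fun p : Σ l, B.obj l => (⟨p.1, g p.1 p.2⟩ : Σ l, B'.obj l)) ht.mid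
  · exact congrArg (fun p : Σ l, D.obj l => (⟨p.1, h p.1 p.2⟩ : Σ l, D'.obj l)) ht.snd
  · exact ht.rel

/-- The points of `X 2` are handled by `AssocRel.pentagon`, and the four elements are carried along
unchanged. Intermediate terms enter only through their components, which avoids casts between
degrees. -/
theorem AssocEltRel.pentagon {A B D E : Ξ → Type u}
    {t : P.TensorElt (P.TensorElt (P.TensorElt A B) D) E m}
    {t₁ : P.TensorElt A (P.TensorElt B D) (tFst t).1} (h₁ : AssocEltRel (tFst t).2 t₁)
    {s₁ : P.TensorElt (P.TensorElt A (P.TensorElt B D)) E m} (hs₁ : tPoint s₁ = tPoint t)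
    (hs₁' : tFst s₁ = ⟨_, t₁⟩) (hs₁'' : tSnd s₁ = tSnd t)
    {s₂ : P.TensorElt A (P.TensorElt (P.TensorElt B D) E) m} (h₂ : AssocEltRel s₁ s₂)
    {t₃ : P.TensorElt B (P.TensorElt D E) (tSnd s₂).1} (h₃ : AssocEltRel (tSnd s₂).2 t₃)
    {s₃ : P.TensorElt A (P.TensorElt B (P.TensorElt D E)) m} (hs₃ : tPoint s₃ = tPoint s₂)
    (hs₃' : tFst s₃ = tFst s₂) (hs₃'' : tSnd s₃ = ⟨_, t₃⟩)
    {r₁ : P.TensorElt (P.TensorElt A B) (P.TensorElt D E) m} (k₁ : AssocEltRel t r₁)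
    {r₂ : P.TensorElt A (P.TensorElt B (P.TensorElt D E)) m} (k₂ : AssocEltRel r₁ r₂) :
    s₃ = r₂ := by
  obtain ⟨a₁, b₁, c₁, h₁⟩ := h₁
  obtain ⟨a₂, b₂, c₂, h₂⟩ := h₂
  obtain ⟨a₃, b₃, c₃, h₃⟩ := h₃
  obtain ⟨a₄, b₄, c₄, k₁⟩ := k₁
  obtain ⟨a₅, b₅, c₅, k₂⟩ := k₂
  rw [hs₁'] at a₂ b₂
  rw [hs₁''] at c₂
  rw [hs₁, hs₁'] at h₂
  rw [b₂] at a₃ b₃ h₃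
  rw [a₄] at a₅ b₅ k₂
  obtain ⟨d₁, d₂, d₃⟩ := h₁.pentagon h₂ h₃ k₁ k₂
  refine tensorElt_ext (hs₃.trans d₁) (hs₃'.trans (a₂.trans (a₁.trans a₅.symm))) ?_
  rw [hs₃'']
  refine sigma_tensorElt_ext d₂ (a₃.trans (b₁.trans b₅.symm)) ?_
  rw [c₅]
  exact sigma_tensorElt_ext d₃ (b₃.trans (c₁.trans b₄.symm)) (c₃.trans (c₂.trans c₄.symm))

theorem assocIso_pentagon (hP : P.FiniteMultiplicities) (A B D E : GradedSet Ξ) :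
    (P.tensor hP).map ((assocIso hP A B D).hom ×ₘ 𝟙 E) ≫
        (assocIso hP A (P.tensorObj hP B D) E).hom ≫
        (P.tensor hP).map (𝟙 A ×ₘ (assocIso hP B D E).hom) =
      (assocIso hP (P.tensorObj hP A B) D E).hom ≫
        (assocIso hP A B (P.tensorObj hP D E)).hom := by
  funext m t
  exact AssocEltRel.pentagon (assocEltRel_hom hP A B D _) rfl rfl rfl
    (assocEltRel_hom hP A (P.tensorObj hP B D) E _) (assocEltRel_hom hP B D E _) rfl rfl rfl
    (assocEltRel_hom hP (P.tensorObj hP A B) D E t)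
    (assocEltRel_hom hP A B (P.tensorObj hP D E) _)

theorem hexagon (hP : P.FiniteMultiplicities) (A B D : GradedSet Ξ) :
    (assocIso hP A B D).hom ≫ (commIso hP A (P.tensorObj hP B D)).hom ≫
        (P.tensor hP).map ((commIso hP B D).hom ×ₘ 𝟙 A) =
      (commIso hP (P.tensorObj hP A B) D).hom ≫
        (P.tensor hP).map (𝟙 D ×ₘ (commIso hP A B).hom) ≫ (assocIso hP D B A).inv := by
  funext m t
  have ht := assocEltRel_hom hP A B D t
  -- Both sides are matched by the associator with the same element, the image of `t` under the two
  -- commutors.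
  refine AssocEltRel.left_unique (D := A.obj) ?_ (assocEltRel_inv hP D B A _)
  exact ⟨ht.snd.symm, ht.mid.symm, ht.fst.symm, ht.rel.swap⟩

/-- The coboundary structure on the category of graded sets. -/
noncomputable def coboundaryStructure (hP : P.FiniteMultiplicities) :
    CoboundaryStructure (P.tensor hP) where
  assoc := assocIso hP
  assoc_naturality := assocIso_naturality hP
  pentagon := assocIso_pentagon hP
  comm := commIso hP
  comm_naturality _ _ := rfl
  comm_comm A B := (commIso hP A B).hom_inv_id
  hexagon := hexagon hP

end OperadicCovering

end RealModuli

theorem mainTheorem11 {Ξ : Type u} [TopologicalSpace Ξ] [DiscreteTopology Ξ]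
    (P : RealModuli.OperadicCovering Ξ) (hP : P.FiniteMultiplicities) :
    ContractibleSpace (RealModuli.positivePart 3) ∧
    RealModuli.pt12_3 ∈ RealModuli.positivePart 3 ∧
    RealModuli.pt1_23 ∈ RealModuli.positivePart 3 ∧
    ∃! S : RealModuli.CoboundaryStructure (P.tensor hP),
      (∀ A B D : RealModuli.GradedSet Ξ, P.IsAssociator hP (S.assoc A B D).hom) ∧
      ∀ A B : RealModuli.GradedSet Ξ, P.IsCommutor hP (S.comm A B).hom := by
  refine ⟨RealModuli.contractibleSpace_positivePart, RealModuli.pt12_3_mem,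
    RealModuli.pt1_23_mem, RealModuli.OperadicCovering.coboundaryStructure hP, ⟨?_, ?_⟩, ?_⟩
  · intro A B D
    exact (RealModuli.OperadicCovering.isAssociator_iff hP _).2 fun m t =>
      RealModuli.OperadicCovering.assocEltRel_hom hP A B D t
  · intro A B m t
    exact ⟨rfl, rfl, rfl⟩
  · rintro S ⟨hS, hS'⟩
    -- The two conditions fix both isomorphisms on every element; the remaining fields are
    -- propositions.
    refine RealModuli.CoboundaryStructure.ext (funext fun A => funext fun B => funext fun D =>
      Iso.ext (funext fun m => funext fun t => ?_)) (funext fun A => funext fun B =>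
      Iso.ext (funext fun m => funext fun t => (hS' A B).apply_eq t))
    exact ((RealModuli.OperadicCovering.isAssociator_iff hP _).1 (hS A B D) m t).right_unique
      (RealModuli.OperadicCovering.assocEltRel_hom hP A B D t)
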